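/- Let $\mathbb S=\mathbb R/\mathbb Z$, let $\mathrm{Diff}^\infty(\mathbb S)$ be the group of smooth orientation-preserving diffeomorphisms of $\mathbb S$, and let $G=(\mathrm{Diff}^\infty(\mathbb S)\circledS C^\infty(\mathbb S))\times\mathbb R$ with the product $(\phi_1,f_1,s_1)*(\phi_2,f_2,s_2)=(\phi_1\circ\phi_2,\,f_2+f_1\circ\phi_2,\,s_1+s_2)$ and with Lie algebra $\mathfrak g=C^\infty(\mathbb S)\times C^\infty(\mathbb S)\times\mathbb R$. Tangent spaces of $G$ are identified with $\mathfrak g$. Put $A=1-\partial_x^2$, which is invertible on $C^\infty(\mathbb S)$. For $u=(u_1,u_2,u_3)$ and $v=(v_1,v_2,v_3)$ in $\mathfrak g$ let $$\langle u,v\rangle_{\mathbb A}=\int_{\mathbb S}\left(u_1v_1+u_{1x}v_{1x}+u_2v_2\right)dx-\frac12\int_{\mathbb S}(u_1v_3+u_3v_1)\,dx+\frac12u_3v_3,$$ extended to a right-invariant metric on $G$, and let $$\Gamma(u,v)=\Big(-A^{-1}\partial_x\big(u_1v_1+\tfrac12u_{1x}v_{1x}+\tfrac12u_2v_2-\tfrac12u_3v_1-\tfrac12u_1v_3\big),\;-\tfrac12u_2v_{1x}-\tfrac12u_{1x}v_2,\;0\Big)$$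 be the Christoffel operator of the two-component Camassa–Holm system with vorticity ($a=2$, $\kappa=s=1$) $$m_t=\alpha u_x-2u_xm-um_x-\rho\rho_x,\qquad \rho_t=-u\rho_x-u_x\rho,\qquad \alpha_t=0,\qquad m=Au .$$ Extend $\Gamma$ right-invariantly: for $p=(\phi,f,s)\in G$, with $U\circ\phi:=(U_1\circ\phi,U_2\circ\phi,U_3)$, set $\Gamma_p(U,V)=\Gamma(U\circ\phi^{-1},V\circ\phi^{-1})\circ\phi$. Let $$R_p(u,v)w=D_1\Gamma_p(w,u)v-D_1\Gamma_p(w,v)u+\Gamma_p(\Gamma_p(w,v),u)-\Gamma_p(\Gamma_p(w,u),v)$$ be the curvature tensor of the associated connection $\nabla_XY=DY\cdot X-\Gamma(X,Y)$, where $D_1\Gamma_p(w,u)v=\frac{d}{d\varepsilon}\big|_{\varepsilon=0}\Gamma_{p+\varepsilon v}(w,u)$ is taken in the Fréchet space $\mathfrak g$. At the identity $p=(\mathrm{id},0,0)$ put $R=R_p$ and $$S(u,v)=\langle R(u,v)v,u\rangle_{\mathbb A},\qquad K(u,v)=\frac{S(u,v)}{\langle u,u\rangle_{\mathbb A}\langle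 v,v\rangle_{\mathbb A}-\langle u,v\rangle_{\mathbb A}^2}.$$ Then the derivatives $D_1\Gamma_p(w,u)v$ at the identity exist for all $u,v,w\in\mathfrak g$, and the following hold. 1. For all $u,v\in\mathfrak g$, $$S(u,v)=\langle\Gamma(u,v),\Gamma(u,v)\rangle_{\mathbb A}-\langle\Gamma(u,u),\Gamma(v,v)\rangle_{\mathbb A}.$$ 2. Let $u=(\cos k_1x,\cos k_2x,\alpha)$ and $v=(\cos l_1x,\cos l_2x,1)$ with $k_1,k_2,l_1,l_2\in\{2\pi,4\pi,6\pi,\dots\}$ and $\alpha\ge 6\max\{k_1^2,l_1^2\}$. Then $S(u,v)>0$. 3. For all fixed $k_1,k_2,l_1,l_2\in\{2\pi,4\pi,6\pi,\dots\}$ (in particular whenever $k_1\ne k_2$ and $l_1\ne l_2$) there is a constant $c>0$, depending only on $k_1,k_2,l_1,l_2$, such that, for $u,v$ as in 2, $K(u,v)\ge c$ for all $\alpha\ge 6\max\{k_1^2,l_1^2\}$; in particular $K(u,v)$ stays bounded away from zero as $\alpha\to\infty$. -/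

import Mathlib

open scoped ContDiff Topology

noncomputable section

namespace TwoCH

/-- `C^∞(𝕊)` for the circle `𝕊 = ℝ/ℤ`: the functions on `ℝ/ℤ` whose 1-periodic lift to `ℝ`
is smooth. -/
def smoothFun : Subalgebra ℝ (UnitAddCircle → ℝ) where
  carrier := {f | ContDiff ℝ ∞ fun x : ℝ => f (x : UnitAddCircle)}
  mul_mem' {f g} hf hg := by
    change ContDiff ℝ ∞ fun x : ℝ => f (x : UnitAddCircle) * g (x : UnitAddCircle)
    exact ContDiff.mul hf hg
  add_mem' {f g} hf hg := by
    change ContDiff ℝ ∞ fun x : ℝ => f (x : UnitAddCircle) + g (x : UnitAddCircle)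
    exact ContDiff.add hf hg
  algebraMap_mem' r := by
    change ContDiff ℝ ∞ fun _ : ℝ => r
    exact contDiff_const

theorem contDiff_lift (f : smoothFun) :
    ContDiff ℝ ∞ fun x : ℝ => (f : UnitAddCircle → ℝ) (x : UnitAddCircle) := f.2

theorem periodic_coe (f : UnitAddCircle → ℝ) :
    Function.Periodic (fun x : ℝ => f (x : UnitAddCircle)) 1 := by
  intro x
  simp

/-- A smooth 1-periodic function on `ℝ`, viewed as an element of `C^∞(𝕊)`. -/
def ofPeriodic (g : ℝ → ℝ) (hp : Function.Periodic g 1) (hg : ContDiff ℝ ∞ g) : smoothFun :=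
  ⟨(hp.lift : UnitAddCircle → ℝ), hg⟩

theorem ofPeriodic_coe (g : ℝ → ℝ) (hp : Function.Periodic g 1) (hg : ContDiff ℝ ∞ g) (x : ℝ) :
    (ofPeriodic g hp hg : UnitAddCircle → ℝ) (x : UnitAddCircle) = g x := rfl

theorem smoothFun_ext {f g : smoothFun}
    (h : ∀ x : ℝ, (f : UnitAddCircle → ℝ) (x : UnitAddCircle)
      = (g : UnitAddCircle → ℝ) (x : UnitAddCircle)) : f = g := by
  apply Subtype.ext
  funext y
  induction y using QuotientAddGroup.induction_on with
  | H x => exact h x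

theorem periodic_deriv {g : ℝ → ℝ} (hp : Function.Periodic g 1) :
    Function.Periodic (deriv g) 1 := by
  intro x
  rw [← deriv_comp_add_const]
  congr 1
  funext y
  exact hp y

theorem contDiff_deriv {g : ℝ → ℝ} (hg : ContDiff ℝ ∞ g) : ContDiff ℝ ∞ (deriv g) :=
  (contDiff_infty_iff_deriv.1 hg).2

theorem differentiable_lift (f : smoothFun) :
    Differentiable ℝ fun x : ℝ => (f : UnitAddCircle → ℝ) (x : UnitAddCircle) :=
  (contDiff_lift f).differentiable (by simp)

/-- The derivative `∂ₓ : C^∞(𝕊) → C^∞(𝕊)`. -/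
def dx : smoothFun →ₗ[ℝ] smoothFun where
  toFun f := ofPeriodic (deriv fun x : ℝ => (f : UnitAddCircle → ℝ) (x : UnitAddCircle))
    (periodic_deriv (periodic_coe _)) (contDiff_deriv (contDiff_lift f))
  map_add' f g := by
    apply smoothFun_ext
    intro x
    exact deriv_add (differentiable_lift f x) (differentiable_lift g x)
  map_smul' c f := by
    apply smoothFun_ext
    intro x
    exact deriv_const_smul c (differentiable_lift f x)

theorem dx_coe (f : smoothFun) (x : ℝ) :
    (dx f : UnitAddCircle → ℝ) (x : UnitAddCircle)
      = deriv (fun y : ℝ => (f : UnitAddCircle → ℝ) (y : UnitAddCircle)) x := rfl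

theorem hasDerivAt_lift (f : smoothFun) (x : ℝ) :
    HasDerivAt (fun y : ℝ => (f : UnitAddCircle → ℝ) (y : UnitAddCircle))
      ((dx f : UnitAddCircle → ℝ) (x : UnitAddCircle)) x :=
  (differentiable_lift f x).hasDerivAt

theorem dx_sub_injective {c : ℝ} (hc : c ≠ 0) :
    Function.Injective (dx - c • (LinearMap.id : smoothFun →ₗ[ℝ] smoothFun)) := by
  rw [← LinearMap.ker_eq_bot, LinearMap.ker_eq_bot']
  intro f hf
  have h1 : ∀ x : ℝ, (dx f : UnitAddCircle → ℝ) (x : UnitAddCircle)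
      = c * (f : UnitAddCircle → ℝ) (x : UnitAddCircle) := by
    intro x
    have h2 : dx f = c • f := by
      simpa [sub_eq_zero] using hf
    rw [h2]
    rfl
  have h3 : ∀ x : ℝ, HasDerivAt
      (fun y : ℝ => Real.exp (-(c * y)) * (f : UnitAddCircle → ℝ) (y : UnitAddCircle)) 0 x := by
    intro x
    have h4 : HasDerivAt (fun y : ℝ => Real.exp (-(c * y))) (Real.exp (-(c * x)) * (-(c * 1))) x :=
      (((hasDerivAt_id x).const_mul c).neg).exp
    refine (h4.mul (hasDerivAt_lift f x)).congr_deriv ?_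
    rw [h1 x]
    ring
  have h5 : ∀ x y : ℝ, Real.exp (-(c * x)) * (f : UnitAddCircle → ℝ) (x : UnitAddCircle)
      = Real.exp (-(c * y)) * (f : UnitAddCircle → ℝ) (y : UnitAddCircle) := by
    intro x y
    exact is_const_of_deriv_eq_zero (fun z => (h3 z).differentiableAt) (fun z => (h3 z).deriv) x y
  apply smoothFun_ext
  intro x
  have h6 := h5 (x + 1) x
  have h7 : (f : UnitAddCircle → ℝ) ((x + 1 : ℝ) : UnitAddCircle)
      = (f : UnitAddCircle → ℝ) (x : UnitAddCircle) := periodic_coe _ x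
  rw [h7] at h6
  have h8 : (Real.exp (-(c * (x + 1))) - Real.exp (-(c * x)))
      * (f : UnitAddCircle → ℝ) (x : UnitAddCircle) = 0 := by
    linear_combination h6
  rcases mul_eq_zero.1 h8 with h9 | h9
  · exfalso
    have := Real.exp_injective (sub_eq_zero.1 h9)
    apply hc
    linarith
  · simpa using h9

theorem dx_sub_surjective {c : ℝ} (hc : c ≠ 0) :
    Function.Surjective (dx - c • (LinearMap.id : smoothFun →ₗ[ℝ] smoothFun)) := by
  intro f
  set g : ℝ → ℝ := fun x => (f : UnitAddCircle → ℝ) (x : UnitAddCircle) with hg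
  have hgs : ContDiff ℝ ∞ g := contDiff_lift f
  have hgp : ∀ x, g (x + 1) = g x := periodic_coe _
  set e : ℝ → ℝ := fun t => Real.exp (-(c * t)) * g t with he
  have hes : ContDiff ℝ ∞ e := by fun_prop
  have hec : Continuous e := hes.continuous
  set F : ℝ → ℝ := fun x => ∫ t in (0 : ℝ)..x, e t with hF
  have hFd : ∀ x, HasDerivAt F (e x) x := fun x => hec.integral_hasStrictDerivAt 0 x |>.hasDerivAt
  have hFs : ContDiff ℝ ∞ F := by
    rw [contDiff_infty_iff_deriv]
    refine ⟨fun x => (hFd x).differentiableAt, ?_⟩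
    have : deriv F = e := funext fun x => (hFd x).deriv
    rwa [this]
  have hep : ∀ t, e (t + 1) = Real.exp (-c) * e t := by
    intro t
    simp only [he, hgp]
    rw [← mul_assoc, ← Real.exp_add]
    congr 2
    ring
  have hFp : ∀ x, F (x + 1) = F 1 + Real.exp (-c) * F x := by
    intro x
    have h1 : F (x + 1) = F 1 + ∫ t in (1 : ℝ)..(x + 1), e t :=
      (intervalIntegral.integral_add_adjacent_intervals (hec.intervalIntegrable _ _)
        (hec.intervalIntegrable _ _)).symm
    have h2 : ∫ t in (1 : ℝ)..(x + 1), e t = ∫ t in (0 : ℝ)..x, e (t + 1) := by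
      rw [intervalIntegral.integral_comp_add_right]
      simp
    rw [h1, h2]
    simp only [hep, intervalIntegral.integral_const_mul, hF]
  have hne : 1 - Real.exp c ≠ 0 := by
    intro h
    apply hc
    have : Real.exp c = 1 := by linarith
    exact (Real.exp_eq_one_iff c).1 this
  set C : ℝ := Real.exp c * F 1 / (1 - Real.exp c) with hC
  have hCe : C = Real.exp c * (C + F 1) := by
    rw [hC]
    field_simp
    ring
  set y : ℝ → ℝ := fun x => Real.exp (c * x) * (C + F x) with hy
  have hys : ContDiff ℝ ∞ y := by fun_prop
  have hyp : Function.Periodic y 1 := by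
    intro x
    have h1 : Real.exp (c * (x + 1)) = Real.exp (c * x) * Real.exp c := by
      rw [← Real.exp_add]
      congr 1
      ring
    have h2 : Real.exp c * Real.exp (-c) = 1 := by
      rw [← Real.exp_add]
      simp
    simp only [hy, hFp, h1]
    linear_combination Real.exp (c * x) * F x * h2 - Real.exp (c * x) * hCe
  have hyd : ∀ x, HasDerivAt y (c * y x + g x) x := by
    intro x
    have h4 : HasDerivAt (fun z : ℝ => Real.exp (c * z)) (Real.exp (c * x) * (c * 1)) x :=
      ((hasDerivAt_id x).const_mul c).exp
    have h5 : Real.exp (c * x) * Real.exp (-(c * x)) = 1 := by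
      rw [← Real.exp_add]
      simp
    refine (h4.mul ((hFd x).const_add C)).congr_deriv ?_
    simp only [hy, he]
    linear_combination g x * h5
  refine ⟨ofPeriodic y hyp hys, ?_⟩
  apply smoothFun_ext
  intro x
  have h1 : (dx (ofPeriodic y hyp hys) : UnitAddCircle → ℝ) (x : UnitAddCircle)
      = c * y x + g x := (hyd x).deriv
  change (dx (ofPeriodic y hyp hys) : UnitAddCircle → ℝ) (x : UnitAddCircle) - c * y x = g x
  rw [h1]
  ring

/-- The operator `A = 1 - ∂ₓ²` on `C^∞(𝕊)`. -/
def opA : smoothFun →ₗ[ℝ] smoothFun := LinearMap.id - dx ∘ₗ dx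

theorem opA_bijective : Function.Bijective opA := by
  have h : ∀ f, opA f = -((dx - (1 : ℝ) • (LinearMap.id : smoothFun →ₗ[ℝ] smoothFun))
      ((dx - (-1 : ℝ) • (LinearMap.id : smoothFun →ₗ[ℝ] smoothFun)) f)) := by
    intro f
    simp [opA]
    abel
  have h1 : Function.Bijective (dx - (1 : ℝ) • (LinearMap.id : smoothFun →ₗ[ℝ] smoothFun)) :=
    ⟨dx_sub_injective one_ne_zero, dx_sub_surjective one_ne_zero⟩
  have h2 : Function.Bijective (dx - (-1 : ℝ) • (LinearMap.id : smoothFun →ₗ[ℝ] smoothFun)) :=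
    ⟨dx_sub_injective (by norm_num), dx_sub_surjective (by norm_num)⟩
  have h3 : (opA : smoothFun → smoothFun) = Neg.neg ∘
      (dx - (1 : ℝ) • (LinearMap.id : smoothFun →ₗ[ℝ] smoothFun)) ∘
      (dx - (-1 : ℝ) • (LinearMap.id : smoothFun →ₗ[ℝ] smoothFun)) := funext h
  rw [h3]
  exact (neg_involutive.bijective).comp (h1.comp h2)

/-- The inverse `A⁻¹` of `A = 1 - ∂ₓ²` on `C^∞(𝕊)`. -/
def opAinv : smoothFun →ₗ[ℝ] smoothFun :=
  (LinearEquiv.ofBijective opA opA_bijective).symm.toLinearMap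

theorem opA_opAinv (f : smoothFun) : opA (opAinv f) = f :=
  (LinearEquiv.ofBijective opA opA_bijective).apply_symm_apply f

/-- The integral over `𝕊`. -/
def integ (f : smoothFun) : ℝ :=
  ∫ x in (0 : ℝ)..1, (f : UnitAddCircle → ℝ) (x : UnitAddCircle)

/-- A self-map of the circle which is smooth with everywhere positive derivative
(expressed through a lift to `ℝ`). -/
def IsSmoothOriented (φ : UnitAddCircle → UnitAddCircle) : Prop :=
  ∃ Φ : ℝ → ℝ, ContDiff ℝ ∞ Φ ∧ (∀ x, 0 < deriv Φ x) ∧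
    ∀ x : ℝ, ((Φ x : ℝ) : UnitAddCircle) = φ (x : UnitAddCircle)

theorem isSmoothOriented_id : IsSmoothOriented fun x => x :=
  ⟨fun x => x, contDiff_id, by simp, fun _ => rfl⟩

theorem IsSmoothOriented.comp {φ ψ : UnitAddCircle → UnitAddCircle}
    (hφ : IsSmoothOriented φ) (hψ : IsSmoothOriented ψ) :
    IsSmoothOriented fun x => φ (ψ x) := by
  obtain ⟨Φ, h1, h2, h3⟩ := hφ
  obtain ⟨Ψ, h4, h5, h6⟩ := hψ
  refine ⟨fun x => Φ (Ψ x), h1.comp h4, fun x => ?_, fun x => by rw [h3, h6]⟩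
  have h7 : HasDerivAt (fun x => Φ (Ψ x)) (deriv Φ (Ψ x) * deriv Ψ x) x :=
    ((h1.differentiable (by simp) (Ψ x)).hasDerivAt).comp x
      ((h4.differentiable (by simp) x).hasDerivAt)
  rw [h7.deriv]
  exact mul_pos (h2 _) (h5 _)

/-- `Diff^∞(𝕊)`: the group of smooth orientation-preserving diffeomorphisms of the circle,
with composition. -/
def diffS : Subgroup (Equiv.Perm UnitAddCircle) where
  carrier := {φ | IsSmoothOriented φ ∧ IsSmoothOriented φ.symm}
  mul_mem' hφ hψ := ⟨hφ.1.comp hψ.1, hψ.2.comp hφ.2⟩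
  one_mem' := ⟨isSmoothOriented_id, isSmoothOriented_id⟩
  inv_mem' hφ := ⟨hφ.2, hφ.1⟩

/-- The composition `f ∘ φ` for `f ∈ C^∞(𝕊)` and `φ ∈ Diff^∞(𝕊)`. -/
def comp (f : smoothFun) (φ : diffS) : smoothFun :=
  ⟨fun x => (f : UnitAddCircle → ℝ) ((φ : Equiv.Perm UnitAddCircle) x), by
    obtain ⟨Φ, h1, -, h3⟩ := φ.2.1
    change ContDiff ℝ ∞ fun x : ℝ =>
      (f : UnitAddCircle → ℝ) ((φ : Equiv.Perm UnitAddCircle) (x : UnitAddCircle))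
    have h : (fun x : ℝ =>
        (f : UnitAddCircle → ℝ) ((φ : Equiv.Perm UnitAddCircle) (x : UnitAddCircle)))
        = (fun y : ℝ => (f : UnitAddCircle → ℝ) (y : UnitAddCircle)) ∘ Φ := by
      funext x
      simp only [Function.comp]
      rw [h3 x]
    rw [h]
    exact (contDiff_lift f).comp h1⟩

/-- The configuration space `(Diff^∞(𝕊) ⊛ C^∞(𝕊)) × ℝ`. -/
@[ext]
structure LieGrp where
  φ : diffS
  f : smoothFun
  s : ℝ

/-- The group law `(φ₁, f₁, s₁) * (φ₂, f₂, s₂) = (φ₁ ∘ φ₂, f₂ + f₁ ∘ φ₂, s₁ + s₂)`. -/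
instance : Group LieGrp where
  mul p q := ⟨p.φ * q.φ, q.f + comp p.f q.φ, p.s + q.s⟩
  one := ⟨1, 0, 0⟩
  inv p := ⟨p.φ⁻¹, -comp p.f p.φ⁻¹, -p.s⟩
  mul_assoc p q r := by
    apply LieGrp.ext
    · exact mul_assoc p.φ q.φ r.φ
    · change r.f + comp (q.f + comp p.f q.φ) r.φ = (r.f + comp q.f r.φ) + comp p.f (q.φ * r.φ)
      rw [add_assoc]
      rfl
    · exact add_assoc p.s q.s r.s
  one_mul p := by
    apply LieGrp.ext
    · exact one_mul p.φ
    · exact add_zero p.f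
    · exact zero_add p.s
  mul_one p := by
    apply LieGrp.ext
    · exact mul_one p.φ
    · exact zero_add p.f
    · exact add_zero p.s
  inv_mul_cancel p := by
    apply LieGrp.ext
    · exact inv_mul_cancel p.φ
    · change p.f + comp (-comp p.f p.φ⁻¹) p.φ = 0
      apply Subtype.ext
      funext x
      change (p.f : UnitAddCircle → ℝ) x
        + -(p.f : UnitAddCircle → ℝ) ((p.φ : Equiv.Perm UnitAddCircle).symm
            ((p.φ : Equiv.Perm UnitAddCircle) x)) = 0
      rw [Equiv.symm_apply_apply]
      ring
    · exact neg_add_cancel p.s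

/-- The Lie algebra `C^∞(𝕊) × C^∞(𝕊) × ℝ`; it is also the model of every tangent space. -/
abbrev LieAlg : Type := smoothFun × smoothFun × ℝ

/-- The inner product `⟨U, V⟩_𝔸` on the Lie algebra. -/
def innerA (U V : LieAlg) : ℝ :=
  integ (U.1 * V.1) + integ (dx U.1 * dx V.1) + integ (U.2.1 * V.2.1)
    - 1 / 2 * integ (V.2.2 • U.1 + U.2.2 • V.1) + 1 / 2 * (U.2.2 * V.2.2)

/-- The tangent map `TR_p` of the right translation `h ↦ h * p`; its value on `U` does not
depend on the base point `h`. -/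
def rightTrans (p : LieGrp) (U : LieAlg) : LieAlg :=
  (comp U.1 p.φ, comp U.2.1 p.φ, U.2.2)

/-- The right-invariant metric on the tangent space at `p`. -/
def metricAt (p : LieGrp) (U V : LieAlg) : ℝ :=
  innerA (rightTrans p⁻¹ U) (rightTrans p⁻¹ V)

/-- The Christoffel operator `Γ` at the identity. -/
def Gam (U V : LieAlg) : LieAlg :=
  (-opAinv (dx (U.1 * V.1 + (1 / 2 : ℝ) • (dx U.1 * dx V.1) + (1 / 2 : ℝ) • (U.2.1 * V.2.1)
      - (1 / 2 * U.2.2) • V.1 - (1 / 2 * V.2.2) • U.1)),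
    -((1 / 2 : ℝ) • (U.2.1 * dx V.1)) - (1 / 2 : ℝ) • (dx U.1 * V.2.1),
    0)

/-- The right-invariant Christoffel operator `Γ_p` at the point `p`. -/
def GamAt (p : LieGrp) (U V : LieAlg) : LieAlg :=
  rightTrans p (Gam (rightTrans p⁻¹ U) (rightTrans p⁻¹ V))

open Classical in
/-- The point `p + ε v = (φ + ε v₁, f + ε v₂, s + ε v₃)`. It is set to `p` if the map
`φ + ε v₁` of the circle is not in `Diff^∞(𝕊)`, which does not happen for small `ε`. -/
def moved (p : LieGrp) (v : LieAlg) (ε : ℝ) : LieGrp :=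
  if h : ∃ ψ : diffS, ∀ x : UnitAddCircle, (ψ : Equiv.Perm UnitAddCircle) x
      = (p.φ : Equiv.Perm UnitAddCircle) x
        + ((ε * (v.1 : UnitAddCircle → ℝ) x : ℝ) : UnitAddCircle)
  then ⟨h.choose, p.f + ε • v.2.1, p.s + ε * v.2.2⟩
  else p

/-- `d` is the derivative at `ε = 0` of the curve `c` in the Fréchet space `C^∞(𝕊)`:
the difference quotients converge to `d` uniformly with all their derivatives. -/
def HasDerivZero (c : ℝ → smoothFun) (d : smoothFun) : Prop :=
  ∀ n : ℕ, TendstoUniformly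
    (fun (ε : ℝ) (x : UnitAddCircle) => ((dx^[n] (ε⁻¹ • (c ε - c 0))) : UnitAddCircle → ℝ) x)
    (fun x : UnitAddCircle => ((dx^[n] d) : UnitAddCircle → ℝ) x) (𝓝[≠] 0)

/-- `d` is the derivative at `ε = 0` of the curve `c` in `C^∞(𝕊) × C^∞(𝕊) × ℝ`. -/
def HasDerivZeroAlg (c : ℝ → LieAlg) (d : LieAlg) : Prop :=
  HasDerivZero (fun ε => (c ε).1) d.1 ∧ HasDerivZero (fun ε => (c ε).2.1) d.2.1 ∧
    HasDerivAt (fun ε => (c ε).2.2) d.2.2 0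

open Classical in
/-- `D₁Γ_p(w, u)v`, the derivative of `ε ↦ Γ_{p + ε v}(w, u)` at `ε = 0`
(with value `0` if it did not exist). -/
def D1Gam (p : LieGrp) (w u v : LieAlg) : LieAlg :=
  if h : ∃ d : LieAlg, HasDerivZeroAlg (fun ε => GamAt (moved p v ε) w u) d
  then h.choose else 0

/-- The curvature tensor `R_p(u, v)w` of the connection `∇_X Y = DY · X - Γ(X, Y)`. -/
def curv (p : LieGrp) (u v w : LieAlg) : LieAlg :=
  D1Gam p w u v - D1Gam p w v u + GamAt p (GamAt p w v) u - GamAt p (GamAt p w u) v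

/-- The non-normalized sectional curvature `⟨R(u, v)v, u⟩` at `p`. -/
def secS (p : LieGrp) (u v : LieAlg) : ℝ := metricAt p (curv p u v v) u

/-- The normalized sectional curvature at `p`. -/
def secK (p : LieGrp) (u v : LieAlg) : ℝ :=
  secS p u v / (metricAt p u u * metricAt p v v - metricAt p u v ^ 2)

/-- The function `x ↦ cos(2πn x)` on the circle. -/
def cosMode (n : ℕ) : smoothFun :=
  ofPeriodic (fun x => Real.cos (2 * Real.pi * n * x))
    (fun x => by
      have h : 2 * Real.pi * n * (x + 1) = 2 * Real.pi * n * x + n * (2 * Real.pi) := by ring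
      simp only [h]
      exact Real.cos_add_nat_mul_two_pi _ n)
    (by fun_prop)

end TwoCH

end

/-!
Put `T = 1 - A⁻¹ = -∂ₓ A⁻¹ ∂ₓ`, a positive semidefinite operator bounded by the identity on `L²`.

*Existence of `D₁Γ`.* One has `A⁻¹ ∂ₓ = ½ ((1 - ∂ₓ)⁻¹ - (1 + ∂ₓ)⁻¹)`, and conjugating
`(1 + σ ∂ₓ)⁻¹`, `σ = ±1`, by the diffeomorphism `φ = id + v` amounts to conjugating it by the
multiplication with `exp (σ v)` and inserting the factor `φ'` (`comp_resolv`). So along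
`φ = id + ε v` the operator `Γ_φ` is a composition of products, of the fixed operators
`(1 ± ∂ₓ)⁻¹`, and of the curves `exp (± ε v)` and `(1 + ε v')⁻¹` (`GamAt_eq`). The resolvents are
continuous in every `C^n` by the maximum principle (`abs_ev_resolv_le`), and the two curves are
differentiable in every `C^n` because they solve first-order equations in `x`
(`HasDerivZero.of_dx_eq`). The product rule then gives the derivative, which simplifies to
`v₁ ∂ₓ Γ(w, u) - Γ(v₁ ∂ₓ w, u) - Γ(w, v₁ ∂ₓ u)` (`hasDerivZeroAlg_GamAt`).

*The formula for `S`.* The connection is compatible with the metric (`innerA_Gam_add`). Moving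
the outer `Γ` in `Γ(Γ(v, v), u)` and `Γ(Γ(v, u), v)` to the other side of the inner product
produces `⟨Γ(u, v), Γ(u, v)⟩ - ⟨Γ(u, u), Γ(v, v)⟩`, and transport terms which cancel the terms
`v₁ ∂ₓ Γ` of the derivatives. What is left is the integral of a total derivative
(`innerA_Gam_conv`).

*Positivity.* The pairing of `Γ(u, v)` with `Γ(u', v')` is `∫ h T h'` for the densities `h`, `h'`
inside `A⁻¹ ∂ₓ`, plus the pairing of the second components; the latter contribute a nonnegative
amount to `S` (`secS_ge`). For the trigonometric vectors the density of `Γ(u, v)` is dominated by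
`-½ α cos(l₁ x)`, whereas modulo constants the densities of `Γ(u, u)` and `Γ(v, v)` are of size
`α` and `l₁² / 4 ≤ α / 24`. Sup bounds and weighted Cauchy-Schwarz inequalities give
`S ≥ α² / 40` (`secS_modes_ge`). The Gram determinant of the two vectors is positive and `O(α²)`
(`gram_modes_bounds`), which bounds `K` from below.
-/

namespace TwoCH

/-! ### The differential algebra of smooth functions on the circle -/

/-- The value of a smooth function on the circle at the class of a real number. -/
def ev (f : smoothFun) (x : ℝ) : ℝ := (f : UnitAddCircle → ℝ) (x : UnitAddCircle)

theorem ext_ev {f g : smoothFun} (h : ∀ x, ev f x = ev g x) : f = g := smoothFun_ext h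

@[simp] theorem ev_add (f g : smoothFun) (x : ℝ) : ev (f + g) x = ev f x + ev g x := rfl
@[simp] theorem ev_sub (f g : smoothFun) (x : ℝ) : ev (f - g) x = ev f x - ev g x := rfl
@[simp] theorem ev_neg (f : smoothFun) (x : ℝ) : ev (-f) x = -ev f x := rfl
@[simp] theorem ev_mul (f g : smoothFun) (x : ℝ) : ev (f * g) x = ev f x * ev g x := rfl
@[simp] theorem ev_smul (c : ℝ) (f : smoothFun) (x : ℝ) : ev (c • f) x = c * ev f x := rfl
@[simp] theorem ev_zero (x : ℝ) : ev 0 x = 0 := rfl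
@[simp] theorem ev_one (x : ℝ) : ev 1 x = 1 := rfl

theorem contDiff_ev (f : smoothFun) : ContDiff ℝ ∞ (ev f) := contDiff_lift f

theorem continuous_ev (f : smoothFun) : Continuous (ev f) := (contDiff_ev f).continuous

theorem hasDerivAt_ev (f : smoothFun) (x : ℝ) : HasDerivAt (ev f) (ev (dx f) x) x :=
  hasDerivAt_lift f x

theorem ev_dx (f : smoothFun) (x : ℝ) : ev (dx f) x = deriv (ev f) x := rfl

theorem ev_add_one (f : smoothFun) (x : ℝ) : ev f (x + 1) = ev f x := periodic_coe _ x

theorem dx_mul (f g : smoothFun) : dx (f * g) = dx f * g + f * dx g :=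
  ext_ev fun x => ((hasDerivAt_ev f x).mul (hasDerivAt_ev g x)).deriv

@[simp] theorem dx_one : dx 1 = 0 :=
  ext_ev fun x => (hasDerivAt_const x (1 : ℝ)).deriv

@[simp] theorem ev_dx_mul (f g : smoothFun) (x : ℝ) :
    ev (dx (f * g)) x = ev (dx f) x * ev g x + ev f x * ev (dx g) x := by
  rw [dx_mul]; rfl

/-! ### Integration over the circle -/

theorem integ_eq (f : smoothFun) : integ f = ∫ x in (0 : ℝ)..1, ev f x := rfl

theorem intervalIntegrable_ev (f : smoothFun) :
    IntervalIntegrable (ev f) MeasureTheory.volume 0 1 :=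
  (continuous_ev f).intervalIntegrable _ _

theorem integ_add (f g : smoothFun) : integ (f + g) = integ f + integ g :=
  intervalIntegral.integral_add (intervalIntegrable_ev f) (intervalIntegrable_ev g)

theorem integ_smul (c : ℝ) (f : smoothFun) : integ (c • f) = c * integ f :=
  intervalIntegral.integral_const_mul c (ev f)

theorem integ_neg (f : smoothFun) : integ (-f) = -integ f := by
  rw [← neg_one_smul ℝ f, integ_smul]; ring

theorem integ_sub (f g : smoothFun) : integ (f - g) = integ f - integ g := by
  rw [sub_eq_add_neg, integ_add, integ_neg]; ring

@[simp] theorem integ_zero : integ 0 = 0 := by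
  simp [integ_eq]

@[simp] theorem integ_one : integ 1 = 1 := by
  simp [integ_eq]

@[simp] theorem integ_dx (f : smoothFun) : integ (dx f) = 0 := by
  rw [integ_eq, intervalIntegral.integral_eq_sub_of_hasDerivAt
    (fun x _ => hasDerivAt_ev f x) (intervalIntegrable_ev _)]
  have := ev_add_one f 0
  rw [zero_add] at this
  rw [this, sub_self]

theorem integ_by_parts (f g : smoothFun) : integ (dx f * g) = -integ (f * dx g) := by
  have h := integ_dx (f * g)
  rw [dx_mul, integ_add] at h
  linarith

theorem integ_mono {f g : smoothFun} (h : ∀ x, ev f x ≤ ev g x) : integ f ≤ integ g :=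
  intervalIntegral.integral_mono_on zero_le_one (intervalIntegrable_ev f)
    (intervalIntegrable_ev g) fun x _ => h x

theorem integ_sq_nonneg (f : smoothFun) : 0 ≤ integ (f * f) :=
  intervalIntegral.integral_nonneg zero_le_one fun x _ => mul_self_nonneg (ev f x)

/-! ### The resolvents of the derivative -/

theorem opA_apply (f : smoothFun) : opA f = f - dx (dx f) := rfl

theorem opAinv_opA (f : smoothFun) : opAinv (opA f) = f :=
  opA_bijective.1 (opA_opAinv _)

theorem opAinv_eq {f g : smoothFun} (h : opA g = f) : opAinv f = g := by
  rw [← h, opAinv_opA]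

theorem dx_opAinv (f : smoothFun) : dx (opAinv f) = opAinv (dx f) := by
  symm
  apply opAinv_eq
  conv_rhs => rw [← opA_opAinv f]
  simp [opA_apply]

theorem dx_dx_opAinv (f : smoothFun) : dx (dx (opAinv f)) = opAinv f - f := by
  have := opA_opAinv f
  rw [opA_apply] at this
  linear_combination -this

theorem integ_opAinv (f : smoothFun) : integ (opAinv f) = integ f := by
  conv_rhs => rw [← opA_opAinv f, opA_apply, integ_sub, integ_dx, sub_zero]

/-- The resolvent `(1 + σ ∂ₓ)⁻¹` for a sign `σ = ±1`, written as `A⁻¹ (1 - σ ∂ₓ)`. -/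
noncomputable def resolv (σ : ℝ) : smoothFun →ₗ[ℝ] smoothFun :=
  opAinv ∘ₗ (LinearMap.id - σ • dx)

theorem resolv_apply (σ : ℝ) (f : smoothFun) : resolv σ f = opAinv (f - σ • dx f) := rfl

theorem resolv_add_dx {σ : ℝ} (hσ : σ * σ = 1) (f : smoothFun) :
    resolv σ f + σ • dx (resolv σ f) = f := by
  rw [resolv_apply, dx_opAinv, ← map_smul opAinv, ← map_add]
  apply opAinv_eq
  simp only [opA_apply, map_sub, map_smul, smul_sub, smul_smul, hσ, one_smul]
  abel

theorem resolv_eq {σ : ℝ} (hσ : σ * σ = 1) {f g : smoothFun} (h : f + σ • dx f = g) :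
    resolv σ g = f := by
  rw [← h, resolv_apply]
  apply opAinv_eq
  simp only [opA_apply, map_add, map_smul, smul_add, smul_smul, hσ, one_smul]
  abel

theorem dx_resolv (σ : ℝ) (f : smoothFun) : dx (resolv σ f) = resolv σ (dx f) := by
  rw [resolv_apply, dx_opAinv, resolv_apply]
  simp

/-- `A⁻¹ ∂ₓ` is half the difference of the two resolvents of `∂ₓ`. -/
theorem opAinv_dx_eq (f : smoothFun) :
    opAinv (dx f) = (1 / 2 : ℝ) • (resolv (-1) f - resolv 1 f) := by
  rw [resolv_apply, resolv_apply, ← map_sub, ← map_smul opAinv]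
  congr 1
  apply ext_ev; intro x
  simp; ring

theorem opAinv_eq_resolv (f : smoothFun) :
    opAinv f = (1 / 2 : ℝ) • (resolv (-1) f + resolv 1 f) := by
  rw [resolv_apply, resolv_apply, ← map_add, ← map_smul opAinv]
  congr 1
  apply ext_ev; intro x
  simp; ring

/-- Maximum principle: at an extremum of `(1 + σ ∂ₓ)⁻¹ f` its derivative vanishes, so that
the extremal value is a value of `f`. -/
theorem abs_ev_resolv_le {σ : ℝ} (hσ : σ * σ = 1) {f : smoothFun} {M : ℝ}
    (hM : ∀ x, |ev f x| ≤ M) (x : ℝ) : |ev (resolv σ f) x| ≤ M := by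
  set y := resolv σ f with hy
  have hyf : ∀ x, ev y x + σ * ev (dx y) x = ev f x := fun x => by
    conv_rhs => rw [← resolv_add_dx hσ f]
    rfl
  -- the continuous 1-periodic function `|y|` attains its maximum over `ℝ`
  obtain ⟨z, -, hz⟩ := isCompact_Icc.exists_isMaxOn
    (Set.nonempty_Icc.2 (zero_le_one' ℝ)) (continuous_ev y).abs.continuousOn
  have hmax : ∀ x, |ev y x| ≤ |ev y z| := fun x => by
    have hp : Function.Periodic (ev y) 1 := ev_add_one y
    obtain ⟨w, hw, hxw⟩ := hp.exists_mem_Ico₀ one_pos x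
    rw [hxw]
    exact hz ⟨hw.1, hw.2.le⟩
  have hd : ev (dx y) z = 0 := by
    rcases le_total 0 (ev y z) with h | h
    · refine IsLocalMax.hasDerivAt_eq_zero (Filter.Eventually.of_forall fun x => ?_)
        (hasDerivAt_ev y z)
      have := hmax x
      rw [abs_of_nonneg h] at this
      exact (le_abs_self _).trans this
    · refine IsLocalMin.hasDerivAt_eq_zero (Filter.Eventually.of_forall fun x => ?_)
        (hasDerivAt_ev y z)
      have := hmax x
      rw [abs_of_nonpos h] at this
      have := (neg_le_abs (ev y x)).trans this
      show ev y z ≤ ev y x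
      linarith
  have h := hyf z
  rw [hd, mul_zero, add_zero] at h
  exact (hmax x).trans (h ▸ hM z)

/-! ### Convergence and differentiation of curves in the Fréchet algebra -/

/-- A smooth function as an element of the Banach algebra of continuous functions. -/
def toCont (f : smoothFun) : C(UnitAddCircle, ℝ) where
  toFun := f
  continuous_toFun :=
    (QuotientAddGroup.isQuotientMap_mk (N := AddSubgroup.zmultiples (1 : ℝ))).continuous_iff.2
      (continuous_ev f)

theorem norm_toCont_le {f : smoothFun} {M : ℝ} (hM : 0 ≤ M) :
    ‖toCont f‖ ≤ M ↔ ∀ x, |ev f x| ≤ M := by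
  rw [ContinuousMap.norm_le _ hM]
  refine ⟨fun h x => h (x : UnitAddCircle), fun h y => ?_⟩
  induction y using QuotientAddGroup.induction_on with
  | H x => exact h x

theorem abs_ev_le_norm (f : smoothFun) (x : ℝ) : |ev f x| ≤ ‖toCont f‖ :=
  (norm_toCont_le (norm_nonneg _)).1 le_rfl x

/-- Convergence in `C^n(𝕊)`: uniform convergence of the derivatives of order at most `n`. -/
def TendstoC (n : ℕ) (l : Filter ℝ) (c : ℝ → smoothFun) (d : smoothFun) : Prop :=
  ∀ k ≤ n, Filter.Tendsto (fun ε => toCont (dx^[k] (c ε))) l (𝓝 (toCont (dx^[k] d)))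

namespace TendstoC

variable {n : ℕ} {l : Filter ℝ} {c c' : ℝ → smoothFun} {d d' : smoothFun}

theorem zero_iff :
    TendstoC 0 l c d ↔ Filter.Tendsto (fun ε => toCont (c ε)) l (𝓝 (toCont d)) :=
  ⟨fun h => h 0 le_rfl, fun h k hk => by obtain rfl := Nat.le_zero.1 hk; exact h⟩

theorem succ_iff :
    TendstoC (n + 1) l c d ↔ TendstoC 0 l c d ∧ TendstoC n l (fun ε => dx (c ε)) (dx d) := by
  refine ⟨fun h => ⟨zero_iff.2 (h 0 (Nat.zero_le _)), fun k hk => h (k + 1) (by omega)⟩, ?_⟩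
  rintro ⟨h0, h1⟩ (_ | k) hk
  · exact h0 0 le_rfl
  · exact h1 k (by omega)

theorem mono {m : ℕ} (h : TendstoC n l c d) (hm : m ≤ n) : TendstoC m l c d :=
  fun k hk => h k (hk.trans hm)

theorem const (d : smoothFun) : TendstoC n l (fun _ => d) d := fun _ _ => tendsto_const_nhds

theorem congr (h : TendstoC n l c d) (hc : ∀ᶠ ε in l, c ε = c' ε) : TendstoC n l c' d :=
  fun k hk => (h k hk).congr' (hc.mono fun ε hε => by rw [hε])

theorem iterate_dx_add (k : ℕ) (f g : smoothFun) :
    dx^[k] (f + g) = dx^[k] f + dx^[k] g := iterate_map_add dx k f g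

theorem add (h : TendstoC n l c d) (h' : TendstoC n l c' d') :
    TendstoC n l (fun ε => c ε + c' ε) (d + d') := by
  intro k hk
  simp only [iterate_dx_add]
  exact (h k hk).add (h' k hk)

theorem mul : ∀ {n : ℕ} {c c' : ℝ → smoothFun} {d d' : smoothFun},
    TendstoC n l c d → TendstoC n l c' d' → TendstoC n l (fun ε => c ε * c' ε) (d * d') := by
  intro n
  induction n with
  | zero =>
    intro c c' d d' h h'
    exact zero_iff.2 ((zero_iff.1 h).mul (zero_iff.1 h'))
  | succ n ih =>
    intro c c' d d' h h'
    have h0 := h.mono (Nat.le_succ n)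
    have h0' := h'.mono (Nat.le_succ n)
    rw [succ_iff] at h h' ⊢
    refine ⟨zero_iff.2 ((zero_iff.1 h.1).mul (zero_iff.1 h'.1)), ?_⟩
    simp only [dx_mul]
    exact (ih h.2 h0').add (ih h0 h'.2)

theorem smul {r : ℝ → ℝ} {s : ℝ} (hr : Filter.Tendsto r l (𝓝 s)) (h : TendstoC n l c d) :
    TendstoC n l (fun ε => r ε • c ε) (s • d) := by
  intro k hk
  have e : ∀ (a : ℝ) (f : smoothFun), dx^[k] (a • f) = a • dx^[k] f := fun a f => by
    rw [← Module.End.coe_pow, map_smul]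
  simp only [e]
  exact hr.smul (h k hk)

/-- The resolvents of `∂ₓ` are continuous, by the maximum principle. -/
theorem resolv {σ : ℝ} (hσ : σ * σ = 1) (h : TendstoC n l c d) :
    TendstoC n l (fun ε => resolv σ (c ε)) (resolv σ d) := by
  intro k hk
  have e : ∀ f : smoothFun, dx^[k] (TwoCH.resolv σ f) = TwoCH.resolv σ (dx^[k] f) := fun f => by
    induction k generalizing f with
    | zero => rfl
    | succ k ih => rw [Function.iterate_succ_apply, dx_resolv, ih (by omega),
        Function.iterate_succ_apply]
  simp only [e]
  rw [tendsto_iff_norm_sub_tendsto_zero]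
  refine squeeze_zero (fun _ => norm_nonneg _) (fun ε => ?_)
    (tendsto_iff_norm_sub_tendsto_zero.1 (h k hk))
  change ‖toCont (TwoCH.resolv σ (dx^[k] (c ε)) - TwoCH.resolv σ (dx^[k] d))‖
    ≤ ‖toCont (dx^[k] (c ε) - dx^[k] d)‖
  rw [← map_sub, norm_toCont_le (norm_nonneg _)]
  exact abs_ev_resolv_le hσ fun x => abs_ev_le_norm _ x

end TendstoC

theorem hasDerivZero_iff {c : ℝ → smoothFun} {d : smoothFun} :
    HasDerivZero c d ↔ ∀ n, TendstoC n (𝓝[≠] 0) (fun ε => ε⁻¹ • (c ε - c 0)) d := by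
  have h : HasDerivZero c d ↔ ∀ n, Filter.Tendsto
      (fun ε => toCont (dx^[n] (ε⁻¹ • (c ε - c 0)))) (𝓝[≠] 0) (𝓝 (toCont (dx^[n] d))) :=
    forall_congr' fun n => (ContinuousMap.tendsto_iff_tendstoUniformly
      (F := fun ε : ℝ => toCont (dx^[n] (ε⁻¹ • (c ε - c 0)))) (f := toCont (dx^[n] d))).symm
  rw [h]
  exact ⟨fun h n k _ => h k, fun h n => h n n le_rfl⟩

namespace HasDerivZero

variable {c c' : ℝ → smoothFun} {d d' : smoothFun}

theorem const (f : smoothFun) : HasDerivZero (fun _ => f) 0 := by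
  rw [hasDerivZero_iff]
  intro n
  simpa using TendstoC.const (0 : smoothFun)

theorem congr (h : HasDerivZero c d) (hc : ∀ᶠ ε in 𝓝 (0 : ℝ), c ε = c' ε) :
    HasDerivZero c' d := by
  rw [hasDerivZero_iff] at h ⊢
  intro n
  refine (h n).congr ?_
  filter_upwards [hc.filter_mono nhdsWithin_le_nhds] with ε hε
  rw [hε, hc.self_of_nhds]

/-- A differentiable curve is continuous at `0` in every `C^n(𝕊)`. -/
theorem tendstoC (h : HasDerivZero c d) (n : ℕ) : TendstoC n (𝓝[≠] 0) c (c 0) := by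
  have h0 : Filter.Tendsto (fun ε : ℝ => ε) (𝓝[≠] 0) (𝓝 0) :=
    Filter.tendsto_id.mono_left nhdsWithin_le_nhds
  have h1 := (TendstoC.const (n := n) (l := 𝓝[≠] 0) (c 0)).add
    ((hasDerivZero_iff.1 h n).smul h0)
  rw [zero_smul, add_zero] at h1
  refine h1.congr ?_
  filter_upwards [self_mem_nhdsWithin] with ε (hε : ε ≠ 0)
  rw [smul_smul, mul_inv_cancel₀ hε, one_smul]
  abel

theorem add (h : HasDerivZero c d) (h' : HasDerivZero c' d') :
    HasDerivZero (fun ε => c ε + c' ε) (d + d') := by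
  rw [hasDerivZero_iff] at h h' ⊢
  intro n
  refine ((h n).add (h' n)).congr (Filter.Eventually.of_forall fun ε => ?_)
  rw [← smul_add]
  congr 1
  abel

theorem smul (a : ℝ) (h : HasDerivZero c d) : HasDerivZero (fun ε => a • c ε) (a • d) := by
  rw [hasDerivZero_iff] at h ⊢
  intro n
  refine ((h n).smul (tendsto_const_nhds (x := a))).congr
    (Filter.Eventually.of_forall fun ε => ?_)
  rw [← smul_sub, smul_comm]

theorem mul (h : HasDerivZero c d) (h' : HasDerivZero c' d') :
    HasDerivZero (fun ε => c ε * c' ε) (d * c' 0 + c 0 * d') := by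
  rw [hasDerivZero_iff]
  intro n
  refine (((hasDerivZero_iff.1 h n).mul (h'.tendstoC n)).add
    ((TendstoC.const (c 0)).mul (hasDerivZero_iff.1 h' n))).congr
    (Filter.Eventually.of_forall fun ε => ?_)
  apply ext_ev; intro x
  simp; ring

theorem resolv {σ : ℝ} (hσ : σ * σ = 1) (h : HasDerivZero c d) :
    HasDerivZero (fun ε => resolv σ (c ε)) (resolv σ d) := by
  rw [hasDerivZero_iff] at h ⊢
  intro n
  refine ((h n).resolv hσ).congr (Filter.Eventually.of_forall fun ε => ?_)
  simp only [map_smul, map_sub]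

theorem id_smul (f : smoothFun) : HasDerivZero (fun ε => ε • f) f := by
  rw [hasDerivZero_iff]
  intro n
  refine (TendstoC.const f).congr ?_
  filter_upwards [self_mem_nhdsWithin] with ε (hε : ε ≠ 0)
  rw [zero_smul, sub_zero, smul_smul, inv_mul_cancel₀ hε, one_smul]

theorem unique (h : HasDerivZero c d) (h' : HasDerivZero c d') : d = d' := by
  apply Subtype.ext
  funext x
  exact tendsto_nhds_unique ((h 0).tendsto_at x) ((h' 0).tendsto_at x)

/-- A curve through `1` is differentiable in `C^∞(𝕊)` once it is so uniformly and solves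
`∂ₓ c = ε g b` with `b` continuous at `0` in `C^n(𝕊)` whenever `c` is: the equation transfers
regularity from each derivative to the next. -/
theorem of_dx_eq {b : ℝ → smoothFun} {b₀ v : smoothFun} (hc0 : c 0 = 1)
    (h0 : TendstoC 0 (𝓝[≠] 0) (fun ε => ε⁻¹ • (c ε - 1)) v)
    (hb : ∀ n, TendstoC n (𝓝[≠] 0) c 1 → TendstoC n (𝓝[≠] 0) b b₀)
    (hv : dx v = b₀)
    (hdx : ∀ᶠ ε in 𝓝[≠] (0 : ℝ), dx (c ε) = ε • b ε) : HasDerivZero c v := by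
  have hid : Filter.Tendsto (fun ε : ℝ => ε) (𝓝[≠] 0) (𝓝 0) :=
    Filter.tendsto_id.mono_left nhdsWithin_le_nhds
  have h1 : TendstoC 0 (𝓝[≠] 0) c 1 := by
    have := (TendstoC.const (n := 0) (l := 𝓝[≠] 0) (1 : smoothFun)).add (h0.smul hid)
    rw [zero_smul, add_zero] at this
    refine this.congr ?_
    filter_upwards [self_mem_nhdsWithin] with ε (hε : ε ≠ 0)
    rw [smul_smul, mul_inv_cancel₀ hε, one_smul]
    abel
  have h2 : ∀ n, TendstoC n (𝓝[≠] 0) c 1 := by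
    intro n
    induction n with
    | zero => exact h1
    | succ n ih =>
      rw [TendstoC.succ_iff]
      refine ⟨h1, ?_⟩
      have := (hb n ih).smul hid
      rw [zero_smul] at this
      rw [dx_one]
      exact this.congr (hdx.mono fun ε hε => hε.symm)
  rw [hasDerivZero_iff, hc0]
  rintro (_ | n)
  · exact h0
  · rw [TendstoC.succ_iff]
    refine ⟨h0, ?_⟩
    rw [hv]
    refine (hb n (h2 n)).congr ?_
    filter_upwards [hdx, self_mem_nhdsWithin] with ε hε (hε0 : ε ≠ 0)
    rw [map_smul, map_sub, dx_one, sub_zero, hε, smul_smul, inv_mul_cancel₀ hε0, one_smul]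

end HasDerivZero

theorem HasDerivZeroAlg.unique {c : ℝ → LieAlg} {d d' : LieAlg} (h : HasDerivZeroAlg c d)
    (h' : HasDerivZeroAlg c d') : d = d' :=
  Prod.ext (h.1.unique h'.1) (Prod.ext (h.2.1.unique h'.2.1) (h.2.2.unique h'.2.2))

/-! ### The exponential and the inverse of a small perturbation -/

/-- The pointwise exponential of a smooth function. -/
noncomputable def expFun (f : smoothFun) : smoothFun :=
  ofPeriodic (fun x => Real.exp (ev f x)) (fun x => by simp only [ev_add_one])
    (contDiff_ev f).exp

@[simp] theorem ev_expFun (f : smoothFun) (x : ℝ) : ev (expFun f) x = Real.exp (ev f x) := rfl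

theorem dx_expFun (f : smoothFun) : dx (expFun f) = dx f * expFun f :=
  ext_ev fun x => ((hasDerivAt_ev f x).exp).deriv.trans (mul_comm _ _)

theorem expFun_mul_neg (f : smoothFun) : expFun (-f) * expFun f = 1 :=
  ext_ev fun x => by simp [← Real.exp_add]

theorem expFun_zero : expFun 0 = 1 := ext_ev fun x => by simp

theorem isUnit_of_ev_ne_zero {f : smoothFun} (h : ∀ x, ev f x ≠ 0) : IsUnit f := by
  refine IsUnit.of_mul_eq_one (ofPeriodic (fun x => (ev f x)⁻¹)
    (fun x => by simp only [ev_add_one]) ((contDiff_ev f).inv h)) ?_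
  apply ext_ev; intro x
  exact mul_inv_cancel₀ (h x)

theorem eventually_abs_mul_le (M : ℝ) {δ : ℝ} (hδ : 0 < δ) :
    ∀ᶠ ε in 𝓝 (0 : ℝ), |ε| * M ≤ δ := by
  have : Filter.Tendsto (fun ε : ℝ => |ε| * M) (𝓝 0) (𝓝 (|0| * M)) :=
    (continuous_abs.mul continuous_const).tendsto 0
  rw [abs_zero, zero_mul] at this
  exact (this.eventually_lt_const hδ).mono fun _ h => h.le

/-- A quadratic Taylor remainder gives uniform differentiability. -/
theorem tendstoC_zero_of_remainder {c : ℝ → smoothFun} {v : smoothFun} {M : ℝ} (hM : 0 ≤ M)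
    (h : ∀ᶠ ε in 𝓝 (0 : ℝ), ∀ x, |ev (c ε) x - 1 - ε * ev v x| ≤ ε ^ 2 * M) :
    TendstoC 0 (𝓝[≠] 0) (fun ε => ε⁻¹ • (c ε - 1)) v := by
  rw [TendstoC.zero_iff, tendsto_iff_norm_sub_tendsto_zero]
  have hlim : Filter.Tendsto (fun ε : ℝ => |ε| * M) (𝓝[≠] 0) (𝓝 0) := by
    have : Filter.Tendsto (fun ε : ℝ => |ε| * M) (𝓝 0) (𝓝 (|0| * M)) :=
      (continuous_abs.mul continuous_const).tendsto 0
    rw [abs_zero, zero_mul] at this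
    exact this.mono_left nhdsWithin_le_nhds
  refine squeeze_zero' (Filter.Eventually.of_forall fun _ => norm_nonneg _) ?_ hlim
  filter_upwards [h.filter_mono nhdsWithin_le_nhds, self_mem_nhdsWithin] with ε hε
    (hε0 : ε ≠ 0)
  change ‖toCont (ε⁻¹ • (c ε - 1) - v)‖ ≤ _
  rw [norm_toCont_le (by positivity)]
  intro x
  have e : ev (ε⁻¹ • (c ε - 1) - v) x = ε⁻¹ * (ev (c ε) x - 1 - ε * ev v x) := by
    simp only [ev_sub, ev_smul, ev_one]
    field_simp
  rw [e, abs_mul, abs_inv, inv_mul_le_iff₀ (abs_pos.2 hε0), ← mul_assoc, abs_mul_abs_self, ← sq]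
  exact hε x

theorem hasDerivZero_expFun (v : smoothFun) : HasDerivZero (fun ε => expFun (ε • v)) v := by
  refine HasDerivZero.of_dx_eq (b := fun ε => dx v * expFun (ε • v)) (b₀ := dx v * 1)
    (by rw [zero_smul, expFun_zero]) ?_ (fun n h => (TendstoC.const _).mul h) (mul_one _).symm
    (Filter.Eventually.of_forall fun ε => by rw [dx_expFun, map_smul, smul_mul_assoc])
  refine tendstoC_zero_of_remainder (M := ‖toCont v‖ ^ 2) (by positivity) ?_
  filter_upwards [eventually_abs_mul_le ‖toCont v‖ one_pos] with ε hε x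
  have h1 : |ε * ev v x| ≤ |ε| * ‖toCont v‖ := by
    rw [abs_mul]; gcongr; exact abs_ev_le_norm v x
  refine (Real.abs_exp_sub_one_sub_id_le (h1.trans hε)).trans ?_
  rw [← sq_abs, ← sq_abs ε, ← mul_pow]
  gcongr

/-- For small `ε` the function `1 + ε f` is bounded below by `1 / 2`. -/
theorem eventually_half_le (f : smoothFun) :
    ∀ᶠ ε in 𝓝 (0 : ℝ), ∀ x, 1 / 2 ≤ 1 + ε * ev f x := by
  filter_upwards [eventually_abs_mul_le ‖toCont f‖ (one_half_pos (α := ℝ))] with ε hε x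
  have h1 : |ε * ev f x| ≤ |ε| * ‖toCont f‖ := by
    rw [abs_mul]; gcongr; exact abs_ev_le_norm f x
  linarith [neg_abs_le (ε * ev f x)]

theorem eventually_inverse_mul (f : smoothFun) :
    ∀ᶠ ε in 𝓝 (0 : ℝ), Ring.inverse (1 + ε • f) * (1 + ε • f) = 1 := by
  filter_upwards [eventually_half_le f] with ε hε
  refine Ring.inverse_mul_cancel _ (isUnit_of_ev_ne_zero fun x => ?_)
  have := hε x
  simp only [ev_add, ev_one, ev_smul]
  intro h
  linarith

theorem hasDerivZero_inverse (f : smoothFun) :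
    HasDerivZero (fun ε => Ring.inverse (1 + ε • f)) (-f) := by
  refine HasDerivZero.of_dx_eq
    (b := fun ε => -dx f * (Ring.inverse (1 + ε • f) * Ring.inverse (1 + ε • f)))
    (b₀ := -dx f * (1 * 1)) (by simp) ?_ (fun n h => (TendstoC.const _).mul (h.mul h))
    (by simp) ?_
  · refine tendstoC_zero_of_remainder (M := 2 * ‖toCont f‖ ^ 2) (by positivity) ?_
    filter_upwards [eventually_half_le f, eventually_inverse_mul f] with ε h1 h2 x
    set r := Ring.inverse (1 + ε • f)
    have h3 : ev r x * (1 + ε * ev f x) = 1 := by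
      have := congrArg (fun g => ev g x) h2
      simpa using this
    have h4 : ev r x = (1 + ε * ev f x)⁻¹ := eq_inv_of_mul_eq_one_left h3
    have h5 : |ev r x| ≤ 2 := by
      rw [h4, abs_inv, abs_of_pos (by linarith [h1 x]), inv_le_comm₀ (by linarith [h1 x]) two_pos]
      linarith [h1 x]
    -- `(1 + t)⁻¹ - 1 + t = (1 + t)⁻¹ t ^ 2`
    have h6 : ev r x - 1 - ε * ev (-f) x = ev r x * (ε ^ 2 * ev f x ^ 2) := by
      rw [ev_neg]
      linear_combination (1 - ε * ev f x) * h3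
    rw [h6, abs_mul, abs_of_nonneg (by positivity : 0 ≤ ε ^ 2 * ev f x ^ 2)]
    have h7 : ev f x ^ 2 ≤ ‖toCont f‖ ^ 2 := by
      rw [← sq_abs]; gcongr; exact abs_ev_le_norm f x
    calc |ev r x| * (ε ^ 2 * ev f x ^ 2) ≤ 2 * (ε ^ 2 * ‖toCont f‖ ^ 2) := by gcongr
      _ = _ := by ring
  · filter_upwards [(eventually_inverse_mul f).filter_mono nhdsWithin_le_nhds] with ε h2
    set r := Ring.inverse (1 + ε • f)
    have h3 : dx r * (1 + ε • f) + r * (ε • dx f) = 0 := by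
      have := congrArg dx h2
      rwa [dx_mul, map_add, dx_one, zero_add, map_smul] at this
    have h4 : dx r = dx r * (1 + ε • f) * r := by rw [mul_assoc, mul_comm _ r, h2, mul_one]
    rw [h4, eq_neg_of_add_eq_zero_left h3]
    apply ext_ev; intro x
    simp; ring

/-! ### Diffeomorphisms close to the identity -/

/-- If `1 + v'` is bounded below by a positive constant, then `id + v` is a diffeomorphism of
the circle. -/
theorem exists_diffS_id_add {v : smoothFun} (hv : ∀ x, 1 / 2 ≤ 1 + ev (dx v) x) :
    ∃ ψ : diffS, ∀ x : UnitAddCircle, (ψ : Equiv.Perm UnitAddCircle) x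
      = x + (((v : UnitAddCircle → ℝ) x : ℝ) : UnitAddCircle) := by
  set Φ : ℝ → ℝ := fun x => x + ev v x with hΦ
  have hΦs : ContDiff ℝ ∞ Φ := contDiff_id.add (contDiff_ev v)
  have hd : ∀ x, HasDerivAt Φ (1 + ev (dx v) x) x := fun x =>
    (hasDerivAt_id x).add (hasDerivAt_ev v x)
  have hpos : ∀ x, 0 < 1 + ev (dx v) x := fun x => by linarith [hv x]
  have hmono : StrictMono Φ := strictMono_of_deriv_pos fun x => by
    rw [(hd x).deriv]; exact hpos x
  have hbd : ∀ x, |ev v x| ≤ ‖toCont v‖ := abs_ev_le_norm v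
  have hsurj : Function.Surjective Φ := by
    refine hΦs.continuous.surjective ?_ ?_
    · refine Filter.tendsto_atTop_mono (fun x => ?_)
        (Filter.tendsto_atTop_add_const_right _ (-‖toCont v‖) Filter.tendsto_id)
      have := neg_abs_le (ev v x)
      simp only [hΦ, id]
      linarith [hbd x]
    · refine Filter.tendsto_atBot_mono (fun x => ?_)
        (Filter.tendsto_atBot_add_const_right _ ‖toCont v‖ Filter.tendsto_id)
      have := le_abs_self (ev v x)
      simp only [hΦ, id]
      linarith [hbd x]
  set e : ℝ ≃ₜ ℝ := (hmono.orderIsoOfSurjective Φ hsurj).toHomeomorph with he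
  have hes : ∀ x, Φ (e.symm x) = x := fun x => e.apply_symm_apply x
  have hse : ∀ x, e.symm (Φ x) = x := fun x => e.symm_apply_apply x
  have hsymm : ContDiff ℝ ∞ e.symm :=
    e.contDiff_symm_deriv (fun x => (hpos x).ne') hd hΦs
  have hsymmd : ∀ x, HasDerivAt e.symm (1 + ev (dx v) (e.symm x))⁻¹ x := fun x =>
    HasDerivAt.of_local_left_inverse e.symm.continuous.continuousAt (hd _) (hpos _).ne'
      (Filter.Eventually.of_forall hes)
  have hΦ1 : ∀ x, Φ (x + 1) = Φ x + 1 := fun x => by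
    simp only [hΦ, ev_add_one]; ring
  have hs1 : ∀ x, e.symm (x + 1) = e.symm x + 1 := fun x => by
    apply hmono.injective
    rw [hΦ1, hes, hes]
  have hper : Function.Periodic (fun x : ℝ => ((e.symm x : ℝ) : UnitAddCircle)) 1 := fun x => by
    simp [hs1]
  have hF : ∀ x : ℝ, (x : UnitAddCircle) + ((v : UnitAddCircle → ℝ) (x : UnitAddCircle) : ℝ)
      = ((Φ x : ℝ) : UnitAddCircle) := fun _ => rfl
  have hG : ∀ x : ℝ, hper.lift (x : UnitAddCircle) = ((e.symm x : ℝ) : UnitAddCircle) :=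
    fun _ => rfl
  let P : Equiv.Perm UnitAddCircle :=
    { toFun := fun x => x + (((v : UnitAddCircle → ℝ) x : ℝ) : UnitAddCircle)
      invFun := hper.lift
      left_inv := fun y => by
        induction y using QuotientAddGroup.induction_on with
        | H x =>
          change hper.lift ((Φ x : ℝ) : UnitAddCircle) = _
          rw [hG, hse]
      right_inv := fun y => by
        induction y using QuotientAddGroup.induction_on with
        | H x =>
          change ((Φ (e.symm x) : ℝ) : UnitAddCircle) = _
          rw [hes] }
  refine ⟨⟨P, ⟨Φ, hΦs, fun x => ?_, fun _ => rfl⟩, ⟨e.symm, hsymm, fun x => ?_, fun _ => rfl⟩⟩,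
    fun _ => rfl⟩
  · rw [(hd x).deriv]; exact hpos x
  · rw [(hsymmd x).deriv]; exact inv_pos.2 (hpos _)

theorem eventually_moved_apply (v : LieAlg) :
    ∀ᶠ ε in 𝓝 (0 : ℝ), ∀ x : UnitAddCircle,
      ((moved 1 v ε).φ : Equiv.Perm UnitAddCircle) x
        = x + (((ε • v.1 : smoothFun) : UnitAddCircle → ℝ) x : ℝ) := by
  filter_upwards [eventually_half_le (dx v.1)] with ε hε
  have h : ∃ ψ : diffS, ∀ x : UnitAddCircle, (ψ : Equiv.Perm UnitAddCircle) x
      = ((1 : LieGrp).φ : Equiv.Perm UnitAddCircle) x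
        + ((ε * (v.1 : UnitAddCircle → ℝ) x : ℝ) : UnitAddCircle) :=
    exists_diffS_id_add (v := ε • v.1) fun x => by
      rw [map_smul]; exact hε x
  unfold moved
  rw [dif_pos h]
  exact h.choose_spec

/-! ### Conjugation of the Christoffel operator by a diffeomorphism -/

section Conjugation

variable {φ : diffS} {v : smoothFun}

theorem comp_inv_comp (f : smoothFun) (φ : diffS) : comp (comp f φ⁻¹) φ = f := by
  apply Subtype.ext
  funext x
  change (f : UnitAddCircle → ℝ) ((φ : Equiv.Perm UnitAddCircle).symm
    ((φ : Equiv.Perm UnitAddCircle) x)) = _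
  rw [Equiv.symm_apply_apply]

theorem comp_add (f g : smoothFun) (φ : diffS) : comp (f + g) φ = comp f φ + comp g φ := rfl
theorem comp_sub (f g : smoothFun) (φ : diffS) : comp (f - g) φ = comp f φ - comp g φ := rfl
theorem comp_neg (f : smoothFun) (φ : diffS) : comp (-f) φ = -comp f φ := rfl
theorem comp_smul (c : ℝ) (f : smoothFun) (φ : diffS) : comp (c • f) φ = c • comp f φ := rfl

theorem dx_comp (hφ : ∀ x : UnitAddCircle, (φ : Equiv.Perm UnitAddCircle) x
      = x + (((v : UnitAddCircle → ℝ) x : ℝ) : UnitAddCircle)) (f : smoothFun) :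
    dx (comp f φ) = (1 + dx v) * comp (dx f) φ := by
  have e : ∀ (g : smoothFun) (x : ℝ), ev (comp g φ) x = ev g (x + ev v x) := fun g x =>
    congrArg (g : UnitAddCircle → ℝ) (hφ x)
  apply ext_ev; intro x
  rw [ev_mul, e, ev_dx, funext (e f), mul_comm]
  exact ((hasDerivAt_ev f _).comp x ((hasDerivAt_id x).add (hasDerivAt_ev v x))).deriv

/-- Conjugating `(1 + σ ∂ₓ)⁻¹` by `φ = id + v` gives the same resolvent, conjugated by the
multiplication with `exp (σ v)`: the equation `y + σ y' = f` for `y` becomes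
`Y + σ Y' = exp (σ v) φ' (f ∘ φ)` for `Y = exp (σ v) (y ∘ φ)`. -/
theorem comp_resolv (hφ : ∀ x : UnitAddCircle, (φ : Equiv.Perm UnitAddCircle) x
      = x + (((v : UnitAddCircle → ℝ) x : ℝ) : UnitAddCircle)) {σ : ℝ} (hσ : σ * σ = 1)
    (f : smoothFun) :
    comp (resolv σ f) φ
      = expFun (-(σ • v)) * resolv σ (expFun (σ • v) * ((1 + dx v) * comp f φ)) := by
  set y := resolv σ f with hy
  have h1 : comp f φ = comp y φ + σ • comp (dx y) φ := by
    rw [← comp_smul, ← comp_add, resolv_add_dx hσ]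
  have h2 : resolv σ (expFun (σ • v) * ((1 + dx v) * comp f φ)) = expFun (σ • v) * comp y φ := by
    apply resolv_eq hσ
    rw [dx_mul, dx_expFun, dx_comp hφ, h1, map_smul]
    apply ext_ev; intro x
    simp only [ev_add, ev_mul, ev_smul, ev_one]
    linear_combination ev (dx v) x * ev (expFun (σ • v)) x * ev (comp y φ) x * hσ
  rw [h2, ← mul_assoc, expFun_mul_neg, one_mul]

end Conjugation

/-- The part of the density inside `Γ` which is of order zero. -/
noncomputable def flux₀ (U V : LieAlg) : smoothFun :=
  U.1 * V.1 + (1 / 2 : ℝ) • (U.2.1 * V.2.1) - (1 / 2 * U.2.2) • V.1 - (1 / 2 * V.2.2) • U.1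

/-- The part of the density inside `Γ` which contains derivatives. -/
noncomputable def flux₁ (U V : LieAlg) : smoothFun := (1 / 2 : ℝ) • (dx U.1 * dx V.1)

/-- The density `u₁v₁ + ½u₁ₓv₁ₓ + ½u₂v₂ - ½u₃v₁ - ½u₁v₃` inside the first component of `Γ`. -/
noncomputable def flux (U V : LieAlg) : smoothFun := flux₀ U V + flux₁ U V

/-- The second component of `Γ`. -/
noncomputable def gam₂ (U V : LieAlg) : smoothFun :=
  (-1 / 2 : ℝ) • (U.2.1 * dx V.1 + dx U.1 * V.2.1)

theorem Gam_eq (U V : LieAlg) : Gam U V = (-opAinv (dx (flux U V)), gam₂ U V, 0) := by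
  have h1 : U.1 * V.1 + (1 / 2 : ℝ) • (dx U.1 * dx V.1) + (1 / 2 : ℝ) • (U.2.1 * V.2.1)
      - (1 / 2 * U.2.2) • V.1 - (1 / 2 * V.2.2) • U.1 = flux U V := by
    unfold flux flux₀ flux₁; abel
  have h2 : -((1 / 2 : ℝ) • (U.2.1 * dx V.1)) - (1 / 2 : ℝ) • (dx U.1 * V.2.1) = gam₂ U V := by
    apply ext_ev; intro x
    simp [gam₂]; ring
  rw [Gam, h1, h2]

/-- The Christoffel operator at a point over the diffeomorphism `id + v`, in terms of
`r = (1 + v')⁻¹` and operators at the identity. -/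
theorem GamAt_eq {p : LieGrp} {v r : smoothFun}
    (hp : ∀ x : UnitAddCircle, (p.φ : Equiv.Perm UnitAddCircle) x
      = x + (((v : UnitAddCircle → ℝ) x : ℝ) : UnitAddCircle)) (hr : r * (1 + dx v) = 1)
    (U V : LieAlg) :
    GamAt p U V =
      ((1 / 2 : ℝ) •
        (expFun (-v) * resolv 1 (expFun v * ((1 + dx v) * (flux₀ U V + r * r * flux₁ U V)))
          + (-1 : ℝ) • (expFun v *
            resolv (-1) (expFun (-v) * ((1 + dx v) * (flux₀ U V + r * r * flux₁ U V))))),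
        r * gam₂ U V, 0) := by
  have hd : ∀ f : smoothFun, comp (dx (comp f p.φ⁻¹)) p.φ = r * dx f := fun f => by
    conv_rhs => rw [← comp_inv_comp f p.φ, dx_comp hp, ← mul_assoc, hr, one_mul]
  have hc : ∀ f : smoothFun, comp (comp f p.φ⁻¹) p.φ = f := fun f => comp_inv_comp f p.φ
  set U' := rightTrans p⁻¹ U with hU
  set V' := rightTrans p⁻¹ V with hV
  have hflux : comp (flux U' V') p.φ = flux₀ U V + r * r * flux₁ U V := by
    change comp (comp U.1 p.φ⁻¹) p.φ * comp (comp V.1 p.φ⁻¹) p.φ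
        + (1 / 2 : ℝ) • (comp (comp U.2.1 p.φ⁻¹) p.φ * comp (comp V.2.1 p.φ⁻¹) p.φ)
        - (1 / 2 * U.2.2) • comp (comp V.1 p.φ⁻¹) p.φ
        - (1 / 2 * V.2.2) • comp (comp U.1 p.φ⁻¹) p.φ
        + (1 / 2 : ℝ) • (comp (dx (comp U.1 p.φ⁻¹)) p.φ * comp (dx (comp V.1 p.φ⁻¹)) p.φ) = _
    simp only [hc, hd]
    apply ext_ev; intro x
    simp [flux₀, flux₁]; ring
  have hgam : comp (gam₂ U' V') p.φ = r * gam₂ U V := by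
    change (-1 / 2 : ℝ) • (comp (comp U.2.1 p.φ⁻¹) p.φ * comp (dx (comp V.1 p.φ⁻¹)) p.φ
      + comp (dx (comp U.1 p.φ⁻¹)) p.φ * comp (comp V.2.1 p.φ⁻¹) p.φ) = _
    simp only [hc, hd]
    apply ext_ev; intro x
    simp [gam₂]; ring
  unfold GamAt
  rw [← hU, ← hV, Gam_eq, rightTrans]
  refine Prod.ext ?_ (Prod.ext hgam rfl)
  change comp (-opAinv (dx (flux U' V'))) p.φ = _
  rw [opAinv_dx_eq, comp_neg, comp_smul, comp_sub, comp_resolv hp (by norm_num),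
    comp_resolv hp (by norm_num), hflux]
  simp only [one_smul, neg_smul, neg_neg]
  module

/-! ### The derivative of the Christoffel operator -/

/-- The directional derivative `v₁ ∂ₓ U` of `U` along the vector field `v₁`. -/
noncomputable def conv (v U : LieAlg) : LieAlg := (v.1 * dx U.1, v.1 * dx U.2.1, 0)

/-- The derivative `v₁ ∂ₓ Γ(w, u) - Γ(v₁ ∂ₓ w, u) - Γ(w, v₁ ∂ₓ u)` of the right-invariant
Christoffel operator at the identity in the direction `v`. -/
noncomputable def dGam (w u v : LieAlg) : LieAlg :=
  conv v (Gam w u) - Gam (conv v w) u - Gam w (conv v u)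

theorem dx_mul_flux (v w u : LieAlg) :
    dx (v.1 * flux w u)
      = dx v.1 * (flux₀ w u - flux₁ w u) + (flux (conv v w) u + flux w (conv v u)) := by
  apply ext_ev; intro x
  simp [flux, flux₀, flux₁, conv]; ring

/-- The nonlocal terms in the derivative of the conjugated operator recombine into `dGam`. -/
theorem dGam_fst (w u v : LieAlg) :
    (dGam w u v).1 = -(v.1 * opAinv (flux w u)) + opAinv (v.1 * flux w u)
      - opAinv (dx (dx v.1 * (flux₀ w u - flux₁ w u))) := by
  have h1 : opAinv (dx (flux (conv v w) u + flux w (conv v u)))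
      = opAinv (v.1 * flux w u) - v.1 * flux w u
        - opAinv (dx (dx v.1 * (flux₀ w u - flux₁ w u))) := by
    rw [← dx_dx_opAinv (v.1 * flux w u), dx_opAinv, dx_opAinv, dx_mul_flux]
    simp only [map_add]
    abel
  have h2 : (dGam w u v).1 = v.1 * dx (-opAinv (dx (flux w u)))
      + opAinv (dx (flux (conv v w) u + flux w (conv v u))) := by
    simp only [dGam, Gam_eq, conv, Prod.fst_sub, map_add]
    abel
  rw [h2, h1, map_neg, ← dx_opAinv, dx_dx_opAinv]
  ring

theorem dGam_snd (w u v : LieAlg) : (dGam w u v).2.1 = -dx v.1 * gam₂ w u := by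
  simp only [dGam, Gam_eq, Prod.snd_sub, Prod.fst_sub]
  apply ext_ev; intro x
  simp [gam₂, conv]; ring

theorem hasDerivZero_conj_resolv {σ : ℝ} (hσ : σ * σ = 1) (v a b : smoothFun) :
    HasDerivZero (fun ε : ℝ => expFun (-(σ • ε • v)) * resolv σ (expFun (σ • ε • v)
        * ((1 + dx (ε • v)) * (a + Ring.inverse (1 + dx (ε • v))
          * Ring.inverse (1 + dx (ε • v)) * b))))
      (-(σ • v) * resolv σ (a + b) + resolv σ (σ • (v * (a + b)) + dx v * (a - b))) := by
  have h1 := hasDerivZero_expFun (-(σ • v))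
  have h2 := hasDerivZero_expFun (σ • v)
  have h3 := hasDerivZero_inverse (dx v)
  have h4 := (HasDerivZero.const 1).add (HasDerivZero.id_smul (dx v))
  have h5 := (h2.mul (h4.mul ((HasDerivZero.const a).add
    ((h3.mul h3).mul (HasDerivZero.const b))))).resolv hσ
  have h6 := h1.mul h5
  have e1 : ∀ ε : ℝ, ε • -(σ • v) = -(σ • ε • v) := fun ε => by rw [smul_neg, smul_comm]
  have e2 : ∀ ε : ℝ, ε • (σ • v) = σ • ε • v := fun ε => smul_comm _ _ _
  simp only [zero_smul, add_zero, Ring.inverse_one, expFun_zero, one_mul, mul_one, zero_add,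
    mul_zero, smul_zero, e1, e2, neg_zero] at h6
  simp only [map_smul]
  convert h6 using 3
  apply ext_ev; intro x
  simp; ring

/-- The derivatives `D₁Γ` exist at the identity. -/
theorem hasDerivZeroAlg_GamAt (w u v : LieAlg) :
    HasDerivZeroAlg (fun ε => GamAt (moved 1 v ε) w u) (dGam w u v) := by
  have hev := (eventually_moved_apply v).and (eventually_inverse_mul (dx v.1))
  simp only [← map_smul] at hev
  replace hev := hev.mono fun ε h => (GamAt_eq h.1 h.2 w u).symm
  refine ⟨?_, ?_, ?_⟩
  · refine HasDerivZero.congr ?_ (hev.mono fun ε h => congrArg Prod.fst h)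
    have h1 := hasDerivZero_conj_resolv (σ := 1) (by norm_num) v.1 (flux₀ w u) (flux₁ w u)
    have h2 := hasDerivZero_conj_resolv (σ := -1) (by norm_num) v.1 (flux₀ w u) (flux₁ w u)
    have h3 := (h1.add (h2.smul (-1))).smul (1 / 2)
    have hf : flux₀ w u + flux₁ w u = flux w u := rfl
    simp only [one_smul, neg_smul, neg_neg, hf] at h3 ⊢
    convert h3 using 1
    rw [dGam_fst, opAinv_dx_eq, opAinv_eq_resolv, opAinv_eq_resolv]
    simp only [map_add, map_neg]
    apply ext_ev; intro x
    simp; ring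
  · refine HasDerivZero.congr ?_ (hev.mono fun ε h => congrArg (fun z => z.2.1) h)
    have h := (hasDerivZero_inverse (dx v.1)).mul (HasDerivZero.const (gam₂ w u))
    simp only [mul_zero, add_zero] at h
    rw [dGam_snd]
    simpa only [map_smul] using h
  · change HasDerivAt (fun _ => (0 : ℝ)) _ 0
    have : (dGam w u v).2.2 = 0 := by simp [dGam, conv, Gam_eq]
    rw [this]
    exact hasDerivAt_const _ _

theorem D1Gam_spec (w u v : LieAlg) :
    HasDerivZeroAlg (fun ε => GamAt (moved 1 v ε) w u) (D1Gam 1 w u v) := by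
  have h : ∃ d : LieAlg, HasDerivZeroAlg (fun ε => GamAt (moved 1 v ε) w u) d :=
    ⟨_, hasDerivZeroAlg_GamAt w u v⟩
  rw [D1Gam, dif_pos h]
  exact h.choose_spec

theorem D1Gam_eq (w u v : LieAlg) : D1Gam 1 w u v = dGam w u v :=
  (D1Gam_spec w u v).unique (hasDerivZeroAlg_GamAt w u v)

/-! ### The metric and its Levi-Civita connection -/

theorem innerA_add_left (U U' V : LieAlg) :
    innerA (U + U') V = innerA U V + innerA U' V := by
  simp only [innerA, Prod.fst_add, Prod.snd_add, map_add, add_mul, integ_add, smul_add,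
    integ_smul, add_smul]
  ring

theorem innerA_smul_left (a : ℝ) (U V : LieAlg) : innerA (a • U) V = a * innerA U V := by
  simp only [innerA, Prod.smul_fst, Prod.smul_snd, map_smul, smul_mul_assoc, integ_add,
    integ_smul, smul_eq_mul]
  ring

theorem innerA_sub_left (U U' V : LieAlg) :
    innerA (U - U') V = innerA U V - innerA U' V := by
  rw [sub_eq_add_neg, ← neg_one_smul ℝ U', innerA_add_left, innerA_smul_left]
  ring

theorem innerA_comm (U V : LieAlg) : innerA U V = innerA V U := by
  simp only [innerA, mul_comm V.1, mul_comm (dx V.1), mul_comm V.2.1, mul_comm V.2.2,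
    add_comm (V.2.2 • U.1)]

theorem flux_comm (U V : LieAlg) : flux U V = flux V U := by
  apply ext_ev; intro x
  simp [flux, flux₀, flux₁]; ring

theorem gam₂_comm (U V : LieAlg) : gam₂ U V = gam₂ V U := by
  apply ext_ev; intro x
  simp [gam₂]; ring

theorem Gam_comm (U V : LieAlg) : Gam U V = Gam V U := by
  rw [Gam_eq, Gam_eq, flux_comm, gam₂_comm]

/-- The inertia operator `A` cancels the nonlocal part of `Γ`, so that its pairing with a
vector is the integral of a local expression. -/
theorem innerA_Gam (U V W : LieAlg) :
    innerA (Gam U V) W = integ (flux U V * dx W.1) + integ (gam₂ U V * W.2.1) := by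
  rw [Gam_eq]
  set y := opAinv (dx (flux U V)) with hy
  have h1 : y - dx (dx y) = dx (flux U V) := by rw [← opA_apply, opA_opAinv]
  have h2 : integ y = 0 := by rw [hy, integ_opAinv, integ_dx]
  have h3 := integ_by_parts (dx y) W.1
  have h4 := integ_by_parts (flux U V) W.1
  rw [← h1, sub_mul, integ_sub] at h4
  have h5 : integ (-y * W.1) = -integ (y * W.1) := by
    rw [← integ_neg]; congr 1; exact ext_ev fun x => by simp
  have h6 : integ (-dx y * dx W.1) = -integ (dx y * dx W.1) := by
    rw [← integ_neg]; congr 1; exact ext_ev fun x => by simp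
  simp only [innerA, map_neg, integ_neg, integ_add, integ_smul, smul_neg, h2, h5, h6]
  linarith

/-- The connection is compatible with the metric: the right-hand side is, up to sign, the
derivative in the direction `v` of the right-invariant metric on constant vectors. -/
theorem innerA_Gam_add (v U W : LieAlg) :
    innerA (Gam v U) W + innerA U (Gam v W)
      = innerA (conv v U) W + innerA U (conv v W) := by
  rw [innerA_comm U (Gam v W), innerA_comm U (conv v W), innerA_Gam, innerA_Gam]
  have h : integ ((flux v U * dx W.1 + gam₂ v U * W.2.1 + (flux v W * dx U.1 + gam₂ v W * U.2.1))
      - (conv v U).1 * W.1 - dx (conv v U).1 * dx W.1 - (conv v U).2.1 * W.2.1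
      - (conv v W).1 * U.1 - dx (conv v W).1 * dx U.1 - (conv v W).2.1 * U.2.1
      + (1 / 2 * W.2.2) • (conv v U).1 + (1 / 2 * U.2.2) • (conv v W).1) = 0 := by
    rw [← integ_dx (-(v.1 * (dx U.1 * dx W.1)) - (1 / 2 * v.2.2) • (U.1 * W.1)
      - v.1 * (U.2.1 * W.2.1))]
    congr 1
    apply ext_ev; intro x
    simp [conv, flux, flux₀, flux₁, gam₂]; ring
  simp only [integ_add, integ_sub, integ_smul] at h
  simp only [innerA, integ_add, integ_smul]
  have h1 : (conv v U).2.2 = 0 := rfl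
  have h2 : (conv v W).2.2 = 0 := rfl
  rw [h1, h2]
  linarith

/-- The local part of the curvature: the second-order terms of the metric cancel in
`⟨R(u, v)v, u⟩`, since the corresponding integrand is a total derivative. -/
theorem innerA_Gam_conv (u v : LieAlg) :
    2 * innerA (Gam (conv u v) v) u - innerA (Gam (conv v v) u) u
      - innerA (Gam v (conv v u)) u
      = innerA (Gam u v) (conv v u) - innerA (Gam v v) (conv u u) := by
  have h : integ ((2 : ℝ) • (flux (conv u v) v * dx u.1) + (2 : ℝ) • (gam₂ (conv u v) v * u.2.1)
      - flux (conv v v) u * dx u.1 - gam₂ (conv v v) u * u.2.1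
      - flux v (conv v u) * dx u.1 - gam₂ v (conv v u) * u.2.1
      - flux u v * dx (conv v u).1 - gam₂ u v * (conv v u).2.1
      + flux v v * dx (conv u u).1 + gam₂ v v * (conv u u).2.1) = 0 := by
    rw [← integ_dx ((1 / 2 : ℝ) • (u.1 * dx u.1 * (dx v.1 * dx v.1)
      + v.2.1 * v.2.1 * (u.1 * dx u.1) - (2 : ℝ) • (u.2.1 * v.2.1 * (u.1 * dx v.1))
      - dx u.1 * dx u.1 * (v.1 * dx v.1) + u.2.1 * u.2.1 * (v.1 * dx v.1)
      + u.2.2 • (dx u.1 * (v.1 * v.1)) - v.2.2 • (u.1 * dx u.1 * v.1)))]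
    congr 1
    apply ext_ev; intro x
    simp [conv, flux, flux₀, flux₁, gam₂]; ring
  simp only [integ_add, integ_sub, integ_smul] at h
  simp only [innerA_Gam]
  linarith

theorem curv_eq (u v w : LieAlg) :
    curv 1 u v w
      = dGam w u v - dGam w v u + Gam (Gam w v) u - Gam (Gam w u) v := by
  rw [curv, D1Gam_eq, D1Gam_eq]
  rfl

theorem metricAt_one (U V : LieAlg) : metricAt 1 U V = innerA U V := rfl

theorem secS_eq (u v : LieAlg) :
    secS 1 u v = innerA (Gam u v) (Gam u v) - innerA (Gam u u) (Gam v v) := by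
  rw [secS, metricAt_one, curv_eq]
  simp only [innerA_add_left, innerA_sub_left, dGam]
  have h1 := innerA_Gam_add u (Gam v v) u
  have h2 := innerA_Gam_add v (Gam u v) u
  have h3 := innerA_Gam_conv u v
  rw [Gam_comm v u] at h2 ⊢
  rw [Gam_comm (Gam v v) u, Gam_comm (Gam u v) v, Gam_comm v (conv u v)]
  rw [innerA_comm (Gam v v) (Gam u u)] at h1
  linarith

/-! ### The quadratic form of the nonlocal part of `Γ` -/

/-- The operator `-∂ₓ A⁻¹ ∂ₓ = 1 - A⁻¹`. -/
noncomputable def opT : smoothFun →ₗ[ℝ] smoothFun := LinearMap.id - opAinv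

theorem opT_apply (f : smoothFun) : opT f = f - opAinv f := rfl

/-- The positive semidefinite form `∫ f (1 - A⁻¹) g` on `C^∞(𝕊)`. -/
noncomputable def formT (f g : smoothFun) : ℝ := integ (f * opT g)

theorem formT_add_right (f g g' : smoothFun) : formT f (g + g') = formT f g + formT f g' := by
  rw [formT, map_add, mul_add, integ_add]; rfl

theorem formT_smul_right (a : ℝ) (f g : smoothFun) : formT f (a • g) = a * formT f g := by
  rw [formT, map_smul, mul_smul_comm, integ_smul]; rfl

theorem formT_comm (f g : smoothFun) : formT f g = formT g f := by
  obtain ⟨y, rfl⟩ := opA_bijective.2 f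
  obtain ⟨z, rfl⟩ := opA_bijective.2 g
  have h1 := integ_by_parts (dx y) z
  have h2 := integ_by_parts (dx z) y
  simp only [formT, opT_apply, opAinv_opA, mul_sub, integ_sub]
  simp only [opA_apply, sub_mul, mul_sub, integ_sub]
  rw [mul_comm z y, mul_comm z (dx (dx y)), mul_comm y (dx (dx z)),
    mul_comm (dx (dx z)) (dx (dx y))]
  rw [mul_comm (dx z) (dx y)] at h2
  linarith

theorem formT_add_left (f f' g : smoothFun) : formT (f + f') g = formT f g + formT f' g := by
  rw [formT_comm, formT_add_right, formT_comm g, formT_comm g]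

theorem formT_smul_left (a : ℝ) (f g : smoothFun) : formT (a • f) g = a * formT f g := by
  rw [formT_comm, formT_smul_right, formT_comm g]

theorem formT_self_nonneg (f : smoothFun) : 0 ≤ formT f f := by
  obtain ⟨z, rfl⟩ := opA_bijective.2 f
  have h1 := integ_by_parts z (dx z)
  have h2 := integ_sq_nonneg (dx z)
  have h3 := integ_sq_nonneg (dx (dx z))
  have h4 : opA z * opT (opA z) = dx (dx z) * dx (dx z) - z * dx (dx z) := by
    rw [opT_apply, opAinv_opA, opA_apply]; ring
  rw [formT, h4, integ_sub]
  linarith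

theorem formT_self_le (f : smoothFun) : formT f f ≤ integ (f * f) := by
  obtain ⟨z, rfl⟩ := opA_bijective.2 f
  have h1 := integ_by_parts z (dx z)
  have h2 := integ_sq_nonneg (dx z)
  have h3 := integ_sq_nonneg z
  have h4 : opA z * opT (opA z) = opA z * opA z - (z * z - z * dx (dx z)) := by
    rw [opT_apply, opAinv_opA, opA_apply]; ring
  rw [formT, h4, integ_sub, integ_sub]
  linarith

/-- Constants lie in the kernel of the form. -/
theorem formT_add_const (f g : smoothFun) (a : ℝ) : formT f (g + a • 1) = formT f g := by
  have h : opT 1 = 0 := by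
    rw [opT_apply, opAinv_eq (g := (1 : smoothFun)) (by simp [opA_apply]), sub_self]
  rw [formT_add_right, formT_smul_right, formT, formT, h, mul_zero,
    integ_zero]
  ring

theorem two_formT_le {t : ℝ} (ht : 0 < t) (f g : smoothFun) :
    2 * formT f g ≤ t * formT f f + t⁻¹ * formT g g := by
  have h := formT_self_nonneg (f + (-t⁻¹) • g)
  simp only [formT_add_left, formT_add_right, formT_smul_left, formT_smul_right,
    formT_comm g f] at h
  have h1 : t * t⁻¹ = 1 := mul_inv_cancel₀ ht.ne'
  have h2 := mul_nonneg ht.le h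
  linear_combination h2 - (2 * formT f g - t⁻¹ * formT g g) * h1

theorem innerA_Gam_Gam (U V U' V' : LieAlg) :
    innerA (Gam U V) (Gam U' V')
      = formT (flux U V) (flux U' V') + integ (gam₂ U V * gam₂ U' V') := by
  rw [innerA_Gam, Gam_eq U' V', formT, opT_apply]
  simp only [map_neg, ← dx_opAinv, dx_dx_opAinv, neg_sub]

/-- The second components of `Γ` contribute `¼ ∫ (u₂ v₁ₓ - u₁ₓ v₂)² ≥ 0` to the curvature. -/
theorem secS_ge (u v : LieAlg) :
    formT (flux u v) (flux u v) - formT (flux u u) (flux v v) ≤ secS 1 u v := by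
  rw [secS_eq, innerA_Gam_Gam, innerA_Gam_Gam]
  have h : gam₂ u v * gam₂ u v - gam₂ u u * gam₂ v v
      = ((1 / 2 : ℝ) • (u.2.1 * dx v.1 - dx u.1 * v.2.1))
        * ((1 / 2 : ℝ) • (u.2.1 * dx v.1 - dx u.1 * v.2.1)) := by
    apply ext_ev; intro x
    simp [gam₂]; ring
  have h1 := integ_sq_nonneg ((1 / 2 : ℝ) • (u.2.1 * dx v.1 - dx u.1 * v.2.1))
  rw [← h, integ_sub] at h1
  linarith

theorem integ_mul_self_le {f : smoothFun} {M : ℝ} (h : ∀ x, |ev f x| ≤ M) :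
    integ (f * f) ≤ M ^ 2 := by
  have h1 : integ (f * f) ≤ integ ((M ^ 2) • (1 : smoothFun)) := integ_mono fun x => by
    rw [ev_mul, ev_smul, ev_one, mul_one, ← sq, ← sq_abs]
    gcongr
    exact h x
  rwa [integ_smul, integ_one, mul_one] at h1

/-! ### Trigonometric modes -/

/-- The function `x ↦ sin(2πn x)` on the circle. -/
noncomputable def sinMode (n : ℕ) : smoothFun :=
  ofPeriodic (fun x => Real.sin (2 * Real.pi * n * x))
    (fun x => by
      have h : 2 * Real.pi * n * (x + 1) = 2 * Real.pi * n * x + n * (2 * Real.pi) := by ring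
      simp only [h]
      exact Real.sin_add_nat_mul_two_pi _ n)
    (by fun_prop)

/-- The wave number `2πn`. -/
noncomputable def freq (n : ℕ) : ℝ := 2 * Real.pi * n

theorem ev_cosMode (n : ℕ) (x : ℝ) : ev (cosMode n) x = Real.cos (freq n * x) := rfl

theorem ev_sinMode (n : ℕ) (x : ℝ) : ev (sinMode n) x = Real.sin (freq n * x) := rfl

theorem dx_cosMode (n : ℕ) : dx (cosMode n) = (-freq n) • sinMode n := by
  apply ext_ev; intro x
  have h : HasDerivAt (fun y : ℝ => freq n * y) (freq n * 1) x :=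
    (hasDerivAt_id x).const_mul _
  rw [ev_dx, funext (ev_cosMode n), h.cos.deriv]
  simp [ev_sinMode]; ring

theorem dx_sinMode (n : ℕ) : dx (sinMode n) = freq n • cosMode n := by
  apply ext_ev; intro x
  have h : HasDerivAt (fun y : ℝ => freq n * y) (freq n * 1) x :=
    (hasDerivAt_id x).const_mul _
  rw [ev_dx, funext (ev_sinMode n), h.sin.deriv]
  simp [ev_cosMode]; ring

theorem le_freq_sq {n : ℕ} (hn : 0 < n) : 39 ≤ freq n ^ 2 := by
  have h1 : (1 : ℝ) ≤ n := by exact_mod_cast hn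
  have h2 := Real.pi_gt_d2
  have h3 : 6.28 ≤ freq n := by
    unfold freq
    nlinarith
  nlinarith

theorem freq_nonneg (n : ℕ) : 0 ≤ freq n := by unfold freq; positivity

theorem freq_ne_zero {n : ℕ} (hn : 0 < n) : freq n ≠ 0 := by
  intro h
  have := le_freq_sq hn
  rw [h] at this
  norm_num at this

theorem integ_cosMode {n : ℕ} (hn : 0 < n) : integ (cosMode n) = 0 := by
  have h := integ_dx (sinMode n)
  rw [dx_sinMode, integ_smul] at h
  exact (mul_eq_zero.1 h).resolve_left (freq_ne_zero hn)

theorem integ_cosMode_sq {n : ℕ} (hn : 0 < n) :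
    integ (cosMode n * cosMode n) = 1 / 2 ∧ integ (sinMode n * sinMode n) = 1 / 2 := by
  have h1 : integ (cosMode n * cosMode n) + integ (sinMode n * sinMode n) = 1 := by
    rw [← integ_add, ← integ_one]
    congr 1
    apply ext_ev; intro x
    simp only [ev_add, ev_mul, ev_cosMode, ev_sinMode, ev_one]
    linear_combination Real.cos_sq_add_sin_sq (freq n * x)
  have h2 := integ_by_parts (sinMode n) (cosMode n)
  rw [dx_sinMode, dx_cosMode, smul_mul_assoc, integ_smul, mul_smul_comm,
    integ_smul, ← neg_mul, neg_neg] at h2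
  have h3 := mul_left_cancel₀ (freq_ne_zero hn) h2
  constructor <;> linarith

theorem formT_cosMode {n : ℕ} (hn : 0 < n) : 39 / 80 ≤ formT (cosMode n) (cosMode n) := by
  have hk := le_freq_sq hn
  have h0 : 1 + freq n ^ 2 ≠ 0 := by positivity
  have h1 : opAinv (cosMode n) = (1 + freq n ^ 2)⁻¹ • cosMode n := by
    apply opAinv_eq
    simp only [opA_apply, map_smul, dx_cosMode, dx_sinMode]
    apply ext_ev; intro x
    simp only [ev_sub, ev_smul]
    field_simp
    ring
  rw [formT, opT_apply, h1, mul_sub, mul_smul_comm, integ_sub, integ_smul,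
    (integ_cosMode_sq hn).1]
  have h2 : (1 + freq n ^ 2)⁻¹ ≤ 40⁻¹ := by gcongr; linarith
  linarith

theorem abs_mul_le_one {a b : ℝ} (ha : |a| ≤ 1) (hb : |b| ≤ 1) : |a * b| ≤ 1 := by
  rw [abs_mul]; exact mul_le_one₀ ha (abs_nonneg b) hb

theorem abs_ev_cosMode_le (n : ℕ) (x : ℝ) : |ev (cosMode n) x| ≤ 1 := Real.abs_cos_le_one _

theorem abs_ev_sinMode_le (n : ℕ) (x : ℝ) : |ev (sinMode n) x| ≤ 1 := Real.abs_sin_le_one _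

/-! ### Lower bounds for the curvature -/

section Modes

variable {m₁ m₂ n₁ n₂ : ℕ} {α : ℝ}

theorem formT_flux_ge (hm₁ : 0 < m₁) (hn₁ : 0 < n₁)
    (hm : 6 * freq m₁ ^ 2 ≤ α) (hn : 6 * freq n₁ ^ 2 ≤ α) :
    3 / 50 * α ^ 2 ≤ formT (flux (cosMode m₁, cosMode m₂, α) (cosMode n₁, cosMode n₂, 1))
      (flux (cosMode m₁, cosMode m₂, α) (cosMode n₁, cosMode n₂, 1)) := by
  have hk := le_freq_sq hm₁
  have hα : 234 ≤ α := by linarith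
  set g := cosMode m₁ * cosMode n₁
    + (1 / 2 * (freq m₁ * freq n₁)) • (sinMode m₁ * sinMode n₁)
    + (1 / 2 : ℝ) • (cosMode m₂ * cosMode n₂) - (1 / 2 : ℝ) • cosMode m₁ with hg
  have hf : flux (cosMode m₁, cosMode m₂, α) (cosMode n₁, cosMode n₂, 1)
      = g + (-(α / 2)) • cosMode n₁ := by
    apply ext_ev; intro x
    simp [flux, flux₀, flux₁, dx_cosMode, hg]; ring
  -- `|g| ≤ 2 + k₁ l₁ / 2`, where `k₁ l₁ ≤ α / 6` and `2 ≤ α / 117`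
  have hgb : ∀ x, |ev g x| ≤ 23 / 250 * α := fun x => by
    have h1 := abs_le.1 (abs_mul_le_one (abs_ev_cosMode_le m₁ x) (abs_ev_cosMode_le n₁ x))
    have h2 := abs_le.1 (abs_mul_le_one (abs_ev_sinMode_le m₁ x) (abs_ev_sinMode_le n₁ x))
    have h3 := abs_le.1 (abs_mul_le_one (abs_ev_cosMode_le m₂ x) (abs_ev_cosMode_le n₂ x))
    have h4 := abs_le.1 (abs_ev_cosMode_le m₁ x)
    have h5 : 0 ≤ freq m₁ * freq n₁ := mul_nonneg (freq_nonneg _) (freq_nonneg _)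
    have h6 : freq m₁ * freq n₁ ≤ α / 6 := by nlinarith [sq_nonneg (freq m₁ - freq n₁)]
    simp only [hg, ev_sub, ev_add, ev_smul, ev_mul] at *
    rw [abs_le]
    constructor <;> nlinarith
  have h1 := (formT_self_le g).trans (integ_mul_self_le hgb)
  have h2 := formT_cosMode hn₁
  have h3 := two_formT_le (t := 3) (by norm_num) g ((α / 2) • cosMode n₁)
  simp only [formT_smul_left, formT_smul_right] at h3
  rw [hf]
  simp only [formT_add_left, formT_add_right, formT_smul_left, formT_smul_right,
    formT_comm (cosMode n₁) g]
  nlinarith [mul_le_mul_of_nonneg_left h2 (sq_nonneg α)]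

/-- The density of `Γ(u, u)` for a single mode: up to a constant it consists of the dominant
first-order term `-a cos` and a remainder of the size of the square of the wave number. -/
theorem flux_self_eq (m₁ m₂ : ℕ) (a : ℝ) :
    flux (cosMode m₁, cosMode m₂, a) (cosMode m₁, cosMode m₂, a)
      = ((-a) • cosMode m₁ + ((1 / 2 - freq m₁ ^ 2 / 4) • ((2 : ℝ) • (cosMode m₁ * cosMode m₁) - 1)
        + (1 / 4 : ℝ) • ((2 : ℝ) • (cosMode m₂ * cosMode m₂) - 1)))
        + (3 / 4 + freq m₁ ^ 2 / 4) • 1 := by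
  apply ext_ev; intro x
  simp only [flux, flux₀, flux₁, dx_cosMode, ev_add, ev_sub, ev_smul, ev_mul, ev_one,
    ev_cosMode, ev_sinMode]
  linear_combination (freq m₁ ^ 2 / 2) * Real.sin_sq_add_cos_sq (freq m₁ * x)

theorem abs_remainder_le (hm₁ : 0 < m₁) (x : ℝ) :
    |ev ((1 / 2 - freq m₁ ^ 2 / 4) • ((2 : ℝ) • (cosMode m₁ * cosMode m₁) - 1)
        + (1 / 4 : ℝ) • ((2 : ℝ) • (cosMode m₂ * cosMode m₂) - 1)) x|
      ≤ freq m₁ ^ 2 / 4 - 1 / 4 := by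
  have hk := le_freq_sq hm₁
  have h1 : ∀ n, |2 * (ev (cosMode n) x * ev (cosMode n) x) - 1| ≤ 1 := fun n => by
    have := abs_le.1 (abs_mul_le_one (abs_ev_cosMode_le n x) (abs_ev_cosMode_le n x))
    have h2 := mul_self_nonneg (ev (cosMode n) x)
    rw [abs_le]; constructor <;> linarith
  simp only [ev_add, ev_smul, ev_sub, ev_mul, ev_one]
  refine (abs_add_le _ _).trans ?_
  rw [abs_mul, abs_mul, abs_of_nonpos (by linarith : 1 / 2 - freq m₁ ^ 2 / 4 ≤ 0),
    abs_of_nonneg (by norm_num : (0 : ℝ) ≤ 1 / 4)]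
  have h2 := mul_le_mul_of_nonneg_left (h1 m₁)
    (by linarith : 0 ≤ -(1 / 2 - freq m₁ ^ 2 / 4))
  linarith [h1 m₂]

theorem formT_flux_flux_le (hm₁ : 0 < m₁) (hn₁ : 0 < n₁)
    (hm : 6 * freq m₁ ^ 2 ≤ α) (hn : 6 * freq n₁ ^ 2 ≤ α) :
    formT (flux (cosMode m₁, cosMode m₂, α) (cosMode m₁, cosMode m₂, α))
      (flux (cosMode n₁, cosMode n₂, 1) (cosMode n₁, cosMode n₂, 1)) ≤ 7 / 200 * α ^ 2 := by
  have hk := le_freq_sq hm₁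
  have hl := le_freq_sq hn₁
  have hα : 234 ≤ α := by linarith
  rw [flux_self_eq, flux_self_eq, formT_add_const, formT_comm, formT_add_const, formT_comm]
  have hG := abs_remainder_le (m₂ := m₂) hm₁
  have hH := abs_remainder_le (m₂ := n₂) hn₁
  set G := (1 / 2 - freq m₁ ^ 2 / 4) • ((2 : ℝ) • (cosMode m₁ * cosMode m₁) - 1)
        + (1 / 4 : ℝ) • ((2 : ℝ) • (cosMode m₂ * cosMode m₂) - 1)
  set H := (1 / 2 - freq n₁ ^ 2 / 4) • ((2 : ℝ) • (cosMode n₁ * cosMode n₁) - 1)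
        + (1 / 4 : ℝ) • ((2 : ℝ) • (cosMode n₂ * cosMode n₂) - 1)
  have h1 : integ (((-α) • cosMode m₁ + G) * ((-α) • cosMode m₁ + G)) ≤ 57 / 100 * α ^ 2 := by
    have h2 : integ (((-α) • cosMode m₁ + G) * ((-α) • cosMode m₁ + G))
        ≤ integ ((11 / 10 * α ^ 2) • (cosMode m₁ * cosMode m₁) + (11 : ℝ) • (G * G)) :=
      integ_mono fun x => by
        simp only [ev_add, ev_mul, ev_smul]
        nlinarith [sq_nonneg (α * ev (cosMode m₁) x + 10 * ev G x)]
    have h3 := integ_mul_self_le (f := G) (M := α / 24) fun x => (hG x).trans (by linarith)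
    rw [integ_add, integ_smul, integ_smul, (integ_cosMode_sq hm₁).1] at h2
    nlinarith
  have h2 : integ (((-1 : ℝ) • cosMode n₁ + H) * ((-1 : ℝ) • cosMode n₁ + H))
      ≤ (9 / 200 * α) ^ 2 := integ_mul_self_le fun x => by
    have h3 := abs_le.1 (hH x)
    have h4 := abs_le.1 (abs_ev_cosMode_le n₁ x)
    simp only [ev_add, ev_smul]
    rw [abs_le]
    constructor <;> linarith
  -- the weight balances the two factors, of sizes about `0.75 α` and `0.045 α`
  have h3 := two_formT_le (t := 1 / 16) (by norm_num) ((-α) • cosMode m₁ + G)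
    ((-1 : ℝ) • cosMode n₁ + H)
  have h4 := formT_self_le ((-α) • cosMode m₁ + G)
  have h5 := formT_self_le ((-1 : ℝ) • cosMode n₁ + H)
  rw [show (1 / 16 : ℝ)⁻¹ = 16 by norm_num] at h3
  nlinarith

/-- The curvature grows quadratically in the third component. -/
theorem secS_modes_ge (hm₁ : 0 < m₁) (hn₁ : 0 < n₁)
    (hm : 6 * freq m₁ ^ 2 ≤ α) (hn : 6 * freq n₁ ^ 2 ≤ α) :
    1 / 40 * α ^ 2 ≤ secS 1 (cosMode m₁, cosMode m₂, α) (cosMode n₁, cosMode n₂, 1) := by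
  have h1 := secS_ge (cosMode m₁, cosMode m₂, α) (cosMode n₁, cosMode n₂, 1)
  have h2 := formT_flux_ge (m₂ := m₂) (n₂ := n₂) hm₁ hn₁ hm hn
  have h3 := formT_flux_flux_le (m₂ := m₂) (n₂ := n₂) hm₁ hn₁ hm hn
  linarith

/-- On vectors with vanishing third component the metric is the sum of the `H¹` and `L²` inner
products. -/
theorem innerA_self_nonneg {U : LieAlg} (hU : U.2.2 = 0) : 0 ≤ innerA U U := by
  have h1 := integ_sq_nonneg U.1
  have h2 := integ_sq_nonneg (dx U.1)
  have h3 := integ_sq_nonneg U.2.1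
  simp only [innerA, hU, zero_smul, add_zero, integ_zero]
  linarith

theorem innerA_modes (hm₁ : 0 < m₁) (hm₂ : 0 < m₂) (a : ℝ) :
    innerA (cosMode m₁, cosMode m₂, a) (cosMode m₁, cosMode m₂, a)
      = 1 + freq m₁ ^ 2 / 2 + a ^ 2 / 2 := by
  have h : integ (dx (cosMode m₁) * dx (cosMode m₁)) = freq m₁ ^ 2 * (1 / 2) := by
    rw [← (integ_cosMode_sq hm₁).2, ← integ_smul]
    congr 1
    apply ext_ev; intro x
    simp [dx_cosMode]; ring
  simp only [innerA, h, (integ_cosMode_sq hm₁).1, (integ_cosMode_sq hm₂).1, integ_add,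
    integ_smul, integ_cosMode hm₁]
  ring

theorem innerA_modes_modes (hm₁ : 0 < m₁) (hn₁ : 0 < n₁) (a b : ℝ) :
    innerA (cosMode m₁, cosMode m₂, a) (cosMode n₁, cosMode n₂, b)
      = innerA (cosMode m₁, cosMode m₂, 0) (cosMode n₁, cosMode n₂, 0) + a * b / 2 := by
  simp only [innerA, integ_add, integ_smul, integ_cosMode hm₁, integ_cosMode hn₁]
  ring

/-- The area of the parallelogram spanned by the two vectors is positive and grows at most
quadratically in the third component. -/
theorem gram_modes_bounds (hm₁ : 0 < m₁) (hm₂ : 0 < m₂) (hn₁ : 0 < n₁) (hn₂ : 0 < n₂)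
    (hm : 6 * freq m₁ ^ 2 ≤ α) :
    let u : LieAlg := (cosMode m₁, cosMode m₂, α)
    let v : LieAlg := (cosMode n₁, cosMode n₂, 1)
    0 < innerA u u * innerA v v - innerA u v ^ 2 ∧
      innerA u u * innerA v v - innerA u v ^ 2
        ≤ (2 + freq m₁ ^ 2 / 2) * (3 / 2 + freq n₁ ^ 2 / 2) * α ^ 2 := by
  intro u v
  have hk := le_freq_sq hm₁
  have hl := le_freq_sq hn₁
  have hα : 234 ≤ α := by linarith
  have e1 : innerA u u = _ := innerA_modes hm₁ hm₂ α
  have e2 : innerA v v = _ := innerA_modes hn₁ hn₂ 1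
  have e3 : innerA u v = _ := innerA_modes_modes hm₁ hn₁ α 1
  set u₀ : LieAlg := (cosMode m₁, cosMode m₂, 0) with hu₀
  set v₀ : LieAlg := (cosMode n₁, cosMode n₂, 0) with hv₀
  have e4 : innerA u₀ u₀ = _ := innerA_modes hm₁ hm₂ 0
  have e5 : innerA v₀ v₀ = _ := innerA_modes hn₁ hn₂ 0
  set a := 1 + freq m₁ ^ 2 / 2 with ha
  set b := 1 + freq n₁ ^ 2 / 2 with hb
  set P := innerA u₀ v₀ with hP
  have hQ : ∀ t : ℝ, 0 ≤ a - 2 * t * P + t ^ 2 * b := fun t => by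
    have h0 : 0 ≤ innerA (u₀ + (-t) • v₀) (u₀ + (-t) • v₀) :=
      innerA_self_nonneg (by simp [hu₀, hv₀])
    have h1 : innerA (u₀ + (-t) • v₀) (u₀ + (-t) • v₀) = a - 2 * t * P + t ^ 2 * b := by
      rw [innerA_add_left, innerA_smul_left, innerA_comm u₀ (_ + _), innerA_comm v₀ (_ + _),
        innerA_add_left, innerA_add_left, innerA_smul_left, innerA_smul_left,
        innerA_comm v₀ u₀, e4, e5]
      ring
    rwa [h1] at h0
  have hb20 : 20 ≤ b := by linarith
  have hCS : P ^ 2 ≤ a * b := by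
    have h := mul_nonneg (by linarith : 0 ≤ b) (hQ (P / b))
    have e : b * (a - 2 * (P / b) * P + (P / b) ^ 2 * b) = a * b - P ^ 2 := by
      field_simp
      ring
    linarith
  have haα : a ≤ α := by linarith
  have e6 : innerA u u * innerA v v - innerA u v ^ 2
      = (a * b - P ^ 2) + a / 2 + α ^ 2 * b / 2 - P * α := by
    rw [e1, e2, e3]; ring
  constructor
  · -- `P α ≤ a + b α² / 4` is the positivity of the form on `u₀ - (α / 2) v₀`
    have h := hQ (α / 2)
    rw [e6]
    nlinarith [mul_le_mul_of_nonneg_left hb20 (sq_nonneg α)]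
  · have h1 : innerA u u ≤ (2 + freq m₁ ^ 2 / 2) * α ^ 2 := by
      rw [e1]
      nlinarith [mul_nonneg (by linarith : (0 : ℝ) ≤ a) (by nlinarith : 0 ≤ α ^ 2 - 1)]
    have h2 : innerA v v = 3 / 2 + freq n₁ ^ 2 / 2 := by rw [e2]; ring
    have h3 : 0 ≤ 3 / 2 + freq n₁ ^ 2 / 2 := by positivity
    rw [h2]
    nlinarith [sq_nonneg (innerA u v), mul_le_mul_of_nonneg_right h1 h3]

theorem secK_modes_ge (hm₁ : 0 < m₁) (hm₂ : 0 < m₂) (hn₁ : 0 < n₁) (hn₂ : 0 < n₂)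
    (hm : 6 * freq m₁ ^ 2 ≤ α) (hn : 6 * freq n₁ ^ 2 ≤ α) :
    1 / 40 / ((2 + freq m₁ ^ 2 / 2) * (3 / 2 + freq n₁ ^ 2 / 2))
      ≤ secK 1 (cosMode m₁, cosMode m₂, α) (cosMode n₁, cosMode n₂, 1) := by
  obtain ⟨h1, h2⟩ := gram_modes_bounds hm₁ hm₂ hn₁ hn₂ hm
  have h3 := secS_modes_ge (m₂ := m₂) (n₂ := n₂) hm₁ hn₁ hm hn
  have hC : 0 < (2 + freq m₁ ^ 2 / 2) * (3 / 2 + freq n₁ ^ 2 / 2) := by positivity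
  simp only [secK, metricAt_one]
  rw [div_le_div_iff₀ hC h1]
  calc 1 / 40 * _ ≤ 1 / 40 * ((2 + freq m₁ ^ 2 / 2) * (3 / 2 + freq n₁ ^ 2 / 2) * α ^ 2) := by
        gcongr
    _ = 1 / 40 * α ^ 2 * ((2 + freq m₁ ^ 2 / 2) * (3 / 2 + freq n₁ ^ 2 / 2)) := by ring
    _ ≤ _ := by gcongr

end Modes

end TwoCH

theorem theorem1p1 :
    -- the curvature tensor at the identity is well defined:
    -- all the derivatives `D₁Γ` in its formula exist
    (∀ u v w : TwoCH.LieAlg,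
      TwoCH.HasDerivZeroAlg (fun ε : ℝ => TwoCH.GamAt (TwoCH.moved 1 v ε) w u)
        (TwoCH.D1Gam 1 w u v)) ∧
    (∀ u v : TwoCH.LieAlg,
      TwoCH.secS 1 u v
        = TwoCH.innerA (TwoCH.Gam u v) (TwoCH.Gam u v)
          - TwoCH.innerA (TwoCH.Gam u u) (TwoCH.Gam v v)) ∧
    (∀ m₁ m₂ n₁ n₂ : ℕ, 0 < m₁ → 0 < m₂ → 0 < n₁ → 0 < n₂ → ∀ α : ℝ,
      6 * max ((2 * Real.pi * m₁) ^ 2) ((2 * Real.pi * n₁) ^ 2) ≤ α →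
      0 < TwoCH.secS 1 (TwoCH.cosMode m₁, TwoCH.cosMode m₂, α)
        (TwoCH.cosMode n₁, TwoCH.cosMode n₂, 1)) ∧
    (∀ m₁ m₂ n₁ n₂ : ℕ, 0 < m₁ → 0 < m₂ → 0 < n₁ → 0 < n₂ →
      ∃ c : ℝ, 0 < c ∧ ∀ α : ℝ,
        6 * max ((2 * Real.pi * m₁) ^ 2) ((2 * Real.pi * n₁) ^ 2) ≤ α →
        c ≤ TwoCH.secK 1 (TwoCH.cosMode m₁, TwoCH.cosMode m₂, α)
          (TwoCH.cosMode n₁, TwoCH.cosMode n₂, 1)) := by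
  have hmax : ∀ {m n : ℕ} {α : ℝ},
      6 * max ((2 * Real.pi * m) ^ 2) ((2 * Real.pi * n) ^ 2) ≤ α →
      6 * TwoCH.freq m ^ 2 ≤ α ∧ 6 * TwoCH.freq n ^ 2 ≤ α := fun {m n α} h =>
    ⟨(mul_le_mul_of_nonneg_left (le_max_left _ _) (by norm_num)).trans h,
      (mul_le_mul_of_nonneg_left (le_max_right _ _) (by norm_num)).trans h⟩
  refine ⟨fun u v w => TwoCH.D1Gam_spec w u v, TwoCH.secS_eq, ?_, ?_⟩
  · intro m₁ m₂ n₁ n₂ hm₁ _ hn₁ _ α hα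
    obtain ⟨hm, hn⟩ := hmax hα
    have hpos : 0 < α := by linarith [TwoCH.le_freq_sq hm₁]
    exact lt_of_lt_of_le (by positivity) (TwoCH.secS_modes_ge hm₁ hn₁ hm hn)
  · intro m₁ m₂ n₁ n₂ hm₁ hm₂ hn₁ hn₂
    refine ⟨1 / 40 / ((2 + TwoCH.freq m₁ ^ 2 / 2) * (3 / 2 + TwoCH.freq n₁ ^ 2 / 2)),
      by positivity, fun α hα => ?_⟩
    obtain ⟨hm, hn⟩ := hmax hα
    exact TwoCH.secK_modes_ge hm₁ hm₂ hn₁ hn₂ hm hn
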